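/- Let $d\ge 1$, let $\mathcal F_0=\{f_i\}_{i=1}^{n_0}$ be a finite (possibly empty) sequence of vectors in $\mathbb C^d$ and let $\mathbf a=(a_1,\dots,a_k)$ be positive numbers with $d-\operatorname{rk} S_{\mathcal F_0}\le k$, where $S_{\mathcal F}=\sum_i f_i\otimes f_i$ denotes the frame operator of a finite sequence $\mathcal F=\{f_i\}$, i.e. $S_{\mathcal F}x=\sum_i\langle x,f_i\rangle f_i$. For a positive semidefinite matrix $S$ let $\lambda(S)$ (resp. $\lambda^\uparrow(S)$) be its vector of eigenvalues, with multiplicity, in decreasing (resp. increasing) order; $x^\downarrow$ is the decreasing rearrangement of a vector $x$, and $x\prec y$ denotes majorization, vectors of different sizes being completed with zeros. Put $\lambda=\lambda(S_{\mathcal F_0})$ and let $$\mathcal C=\{\mathcal F=(\mathcal F_0,\mathcal G):\ \mathcal G=(g_1,\dots,g_k)\in(\mathbb C^d)^k,\ \|g_i\|^2=a_i \text{ for } 1\le i\le k\},$$ $$\mathcal C^{\rm op}=\{\mathcal F=(\mathcal F_0,\mathcal G)\in\mathcal C:\ \lambda(S_{\mathcal F})=(\lambda+\lambda^\uparrow(S_{\mathcal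 G}))^\downarrow\},$$ $$\Gamma_d(\mathbf a)=\{\mu\in\mathbb R_{\ge0}^d:\ \mu_1\le\dots\le\mu_d,\ \mathbf a\prec\mu\},\qquad \Lambda^{\rm op}=\{\lambda+\mu:\ \mu\in\Gamma_d(\mathbf a)\}.$$ Let $f:[0,\infty)\to\mathbb R$ be strictly convex, $P_f(\mathcal F)=\operatorname{tr} f(S_{\mathcal F})$ and $F(\gamma)=\sum_{i=1}^d f(\gamma_i)$ for $\gamma\in\mathbb R_{\ge 0}^d$. Then $\Lambda^{\rm op}$ is convex, and there is a vector $\mu\in\Gamma_d(\mathbf a)$ such that: 1. $\mathcal F=(\mathcal F_0,\mathcal G)\in\mathcal C$ is a global minimizer of $P_f$ on $\mathcal C$ if and only if $\mathcal F\in\mathcal C^{\rm op}$ and $\lambda^\uparrow(S_{\mathcal G})=\mu$; moreover $\mu$ is the only vector of $\Gamma_d(\mathbf a)$ with this property. 2. $F(\lambda+\mu)=\min_{\gamma\in\Gamma_d(\mathbf a)}F(\lambda+\gamma)=\min_{\nu\in\Lambda^{\rm op}}F(\nu)$, and $\mu$ is the only minimizer of $\gamma\mapsto F(\lambda+\gamma)$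 on $\Gamma_d(\mathbf a)$ (so $\mu$ depends only on $\lambda$, $\mathbf a$ and $f$). 3. For $1\le i\le d-1$, if $0<\mu_i=\mu_{i+1}$ then $\lambda_i=\lambda_{i+1}$. -/

import Mathlib

noncomputable section

namespace FrameCompletion

/-- The increasing rearrangement `x↑` of a real vector. -/
def up {m : ℕ} (x : Fin m → ℝ) : Fin m → ℝ := fun i => x (Tuple.sort x i)

/-- The decreasing rearrangement `x↓` of a real vector. -/
def down {m : ℕ} (x : Fin m → ℝ) : Fin m → ℝ := fun i => up x i.rev

/-- `x ≺ y` for two vectors of the same size: the partial sums of `x↓` are at most those of `y↓`,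
and the total sums agree. -/
def MajorizedSame {m : ℕ} (x y : Fin m → ℝ) : Prop :=
  (∀ l : Fin m, ∑ i ∈ Finset.Iic l, down x i ≤ ∑ i ∈ Finset.Iic l, down y i) ∧
    ∑ i, x i = ∑ i, y i

/-- The vector of size `m` obtained from `x` by completing with zeros (used only for `k ≤ m`). -/
def pad {k : ℕ} (m : ℕ) (x : Fin k → ℝ) : Fin m → ℝ :=
  fun i => if h : (i : ℕ) < k then x ⟨i, h⟩ else 0

/-- `x ≺ y` for vectors of possibly different sizes: complete with zeros to the same size. -/
def Majorized {k d : ℕ} (x : Fin k → ℝ) (y : Fin d → ℝ) : Prop :=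
  MajorizedSame (pad (max k d) x) (pad (max k d) y)

/-- The frame operator `S_F = ∑ i, f_i ⊗ f_i` of a finite sequence in `ℂ^d`, as a matrix, where
`(x ⊗ y) z = ⟨z, y⟩ x` (inner product linear in its first entry). -/
def frameOp {d n : ℕ} (F : Fin n → EuclideanSpace ℂ (Fin d)) : Matrix (Fin d) (Fin d) ℂ :=
  ∑ i, Matrix.vecMulVec (F i).ofLp (star (F i).ofLp)

theorem frameOp_isHermitian {d n : ℕ} (F : Fin n → EuclideanSpace ℂ (Fin d)) :
    (frameOp F).IsHermitian := by
  ext i j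
  simp [frameOp, Matrix.conjTranspose_apply, Matrix.sum_apply, Matrix.vecMulVec_apply, mul_comm]

/-- `λ(S_F)`: the eigenvalues of the frame operator, counting multiplicities, in decreasing
order. -/
def eigDown {d n : ℕ} (F : Fin n → EuclideanSpace ℂ (Fin d)) : Fin d → ℝ :=
  down (frameOp_isHermitian F).eigenvalues

/-- `λ↑(S_F)`: the eigenvalues of the frame operator, counting multiplicities, in increasing
order. -/
def eigUp {d n : ℕ} (F : Fin n → EuclideanSpace ℂ (Fin d)) : Fin d → ℝ :=
  up (frameOp_isHermitian F).eigenvalues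

/-- The convex potential `P_f(F) = tr f(S_F)`, where `f(S_F)` is given by functional calculus. -/
def potential {d n : ℕ} (f : ℝ → ℝ) (F : Fin n → EuclideanSpace ℂ (Fin d)) : ℝ :=
  (Matrix.trace (cfc f (frameOp F))).re

/-- The added part `G` of a completed sequence `F = (F₀, G)`. -/
def added {d n₀ k : ℕ} (F : Fin (n₀ + k) → EuclideanSpace ℂ (Fin d)) :
    Fin k → EuclideanSpace ℂ (Fin d) :=
  fun i => F (Fin.natAdd n₀ i)

/-- `C_a(F₀)`: the completions `F = (F₀, G)` of `F₀` with `‖g_i‖² = a_i`. -/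
def completions {d n₀ k : ℕ} (F₀ : Fin n₀ → EuclideanSpace ℂ (Fin d)) (a : Fin k → ℝ) :
    Set (Fin (n₀ + k) → EuclideanSpace ℂ (Fin d)) :=
  {F | (∀ i, F (Fin.castAdd k i) = F₀ i) ∧ ∀ i, ‖added F i‖ ^ 2 = a i}

/-- `C_a^op(F₀)`: the completions with `λ(S_F) = (λ(S_{F₀}) + λ↑(S_G))↓`. -/
def opCompletions {d n₀ k : ℕ} (F₀ : Fin n₀ → EuclideanSpace ℂ (Fin d)) (a : Fin k → ℝ) :
    Set (Fin (n₀ + k) → EuclideanSpace ℂ (Fin d)) :=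
  {F | F ∈ completions F₀ a ∧ eigDown F = down (eigDown F₀ + eigUp (added F))}

/-- `F` is a global minimizer of `P_f` on `C_a(F₀)`. -/
def IsGlobalMinimizer {d n₀ k : ℕ} (f : ℝ → ℝ) (F₀ : Fin n₀ → EuclideanSpace ℂ (Fin d))
    (a : Fin k → ℝ) (F : Fin (n₀ + k) → EuclideanSpace ℂ (Fin d)) : Prop :=
  F ∈ completions F₀ a ∧ ∀ F' ∈ completions F₀ a, potential f F ≤ potential f F'

/-- `Γ_d(a)`: the increasing vectors `μ ∈ ℝ_{≥0}^d` with `a ≺ μ`. -/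
def Gam {k : ℕ} (d : ℕ) (a : Fin k → ℝ) : Set (Fin d → ℝ) :=
  {μ | (∀ i, 0 ≤ μ i) ∧ Monotone μ ∧ Majorized a μ}

/-- `Λ_a^op(lam) = {lam↓ + μ : μ ∈ Γ_d(a)}`. -/
def LamOp {k d : ℕ} (a : Fin k → ℝ) (lam : Fin d → ℝ) : Set (Fin d → ℝ) :=
  {ν | ∃ μ ∈ Gam d a, ν = down lam + μ}

/-- `F(γ) = ∑ i, f(γ_i)`. -/
def sumF {d : ℕ} (f : ℝ → ℝ) (γ : Fin d → ℝ) : ℝ := ∑ i, f (γ i)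

/-- The vector `μ` describes the global minimizers: a sequence is a global minimizer of `P_f` on
`C_a(F₀)` if and only if it lies in `C_a^op(F₀)` and its added part satisfies `λ↑(S_G) = μ`. -/
def DescribesMinimizers {d n₀ k : ℕ} (f : ℝ → ℝ) (F₀ : Fin n₀ → EuclideanSpace ℂ (Fin d))
    (a : Fin k → ℝ) (μ : Fin d → ℝ) : Prop :=
  ∀ F : Fin (n₀ + k) → EuclideanSpace ℂ (Fin d),
    IsGlobalMinimizer f F₀ a F ↔ F ∈ opCompletions F₀ a ∧ eigUp (added F) = μ

end FrameCompletion

end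

/-! The problem over frames reduces to minimizing F(λ+γ) over the convex set Γ_d(a). Lidskii's
inequality gives λ + λ↑(S_G) ≺ λ(S_F), so by Karamata P_f(F) ≥ F(λ + λ↑(S_G)), and Schur's
majorization places λ↑(S_G) in Γ_d(a). Conversely, Schur–Horn realizes any γ in Γ_d(a) as the
spectrum of some S_G diagonal in an eigenbasis of S_{F₀}, with eigenvalues in the opposite order;
that completion has potential F(λ+γ). Hence the two minima agree. The equality case of Karamata
forces minimizers into C^op, and strict convexity makes μ unique.

Existence is the delicate point: Γ_d(a) is compact, but f may jump upward at 0. One minimizes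
instead with f(0) replaced by the limit of f at 0. The rank hypothesis leaves room to move mass onto
a zero entry of λ+μ, which would lower the sum; so the minimizer has λ+μ > 0 everywhere and also
minimizes for f (`exists_minimizer`).

The last claim is a perturbation argument: if λ dropped along a positive plateau of μ, moving mass
from its start to its end would lower F. -/

noncomputable section

namespace FrameCompletion

open Finset

/-! ### Rearrangements and a positive-part criterion for majorization -/

section Rearrangement

variable {m : ℕ}

theorem monotone_up (x : Fin m → ℝ) : Monotone (up x) := Tuple.monotone_sort x

theorem antitone_down (x : Fin m → ℝ) : Antitone (down x) :=
  fun _ _ h => monotone_up x (Fin.rev_le_rev.2 h)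

theorem down_eq_comp_perm (x : Fin m → ℝ) : ∃ σ : Equiv.Perm (Fin m), down x = x ∘ σ :=
  ⟨Fin.revPerm.trans (Tuple.sort x), rfl⟩

theorem sum_up (g : ℝ → ℝ) (x : Fin m → ℝ) : ∑ i, g (up x i) = ∑ i, g (x i) :=
  Equiv.sum_comp (Tuple.sort x) (fun i => g (x i))

theorem sum_comp_rev (x : Fin m → ℝ) : ∑ i, x (Fin.rev i) = ∑ i, x i :=
  Equiv.sum_comp Fin.revPerm x

theorem sum_down (g : ℝ → ℝ) (x : Fin m → ℝ) : ∑ i, g (down x i) = ∑ i, g (x i) := by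
  rw [← sum_up g x]
  exact sum_comp_rev (fun i => g (up x i))

/-- With threshold `y l`, the positive parts for the antitone `y` are exactly its entries up to `l`;
for `x` they only overestimate the prefix. This turns majorization into trace-like inequalities that
suit matrices. -/
theorem sum_Iic_le_of_sum_posPart_le {x y : Fin m → ℝ} (hy : Antitone y) (l : Fin m)
    (h : ∑ i, max (x i - y l) 0 ≤ ∑ i, max (y i - y l) 0) :
    ∑ i ∈ Iic l, x i ≤ ∑ i ∈ Iic l, y i := by
  have h1 : ∑ i ∈ Iic l, (x i - y l) ≤ ∑ i, max (x i - y l) 0 :=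
    (sum_le_sum fun i _ => le_max_left _ _).trans
      (sum_le_sum_of_subset_of_nonneg (subset_univ _) fun i _ _ => le_max_right _ _)
  have h2 : ∑ i, max (y i - y l) 0 = ∑ i ∈ Iic l, (y i - y l) := by
    rw [← sum_subset (subset_univ (Iic l))]
    · refine sum_congr rfl fun i hi => max_eq_left ?_
      exact sub_nonneg.2 (hy (mem_Iic.1 hi))
    · intro i _ hi
      rw [mem_Iic, not_le] at hi
      exact max_eq_right (sub_nonpos.2 (hy hi.le))
  rw [h2] at h
  have h3 := h1.trans h
  rw [sum_sub_distrib, sum_sub_distrib] at h3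
  linarith

theorem eq_of_sum_Iic_eq {x y : Fin m → ℝ}
    (h : ∀ l, ∑ i ∈ Iic l, x i = ∑ i ∈ Iic l, y i) : x = y := by
  funext l
  induction l using WellFoundedLT.induction with
  | ind l ih =>
    have h1 := h l
    rw [← Iio_insert, sum_insert (by simp), sum_insert (by simp),
      sum_congr rfl fun i hi => ih i (mem_Iio.1 hi)] at h1
    linarith

/-- Two antitone vectors with the same entries, counted with multiplicity, agree. -/
theorem eq_of_antitone_of_sum_comp_eq {x y : Fin m → ℝ} (hx : Antitone x) (hy : Antitone y)
    (h : ∀ g : ℝ → ℝ, ∑ i, g (x i) = ∑ i, g (y i)) : x = y :=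
  eq_of_sum_Iic_eq fun l => le_antisymm
    (sum_Iic_le_of_sum_posPart_le hy l (h fun s => max (s - y l) 0).le)
    (sum_Iic_le_of_sum_posPart_le hx l (h fun s => max (s - x l) 0).ge)

theorem down_eq_down {x y : Fin m → ℝ} (h : ∀ g : ℝ → ℝ, ∑ i, g (x i) = ∑ i, g (y i)) :
    down x = down y :=
  eq_of_antitone_of_sum_comp_eq (antitone_down x) (antitone_down y)
    fun g => by rw [sum_down, sum_down, h]

theorem down_eq_self {x : Fin m → ℝ} (h : Antitone x) : down x = x :=
  eq_of_antitone_of_sum_comp_eq (antitone_down x) h fun g => sum_down g x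

theorem down_of_monotone {x : Fin m → ℝ} (h : Monotone x) : down x = fun i => x i.rev :=
  eq_of_antitone_of_sum_comp_eq (antitone_down x) (fun _ _ hij => h (Fin.rev_le_rev.2 hij))
    fun g => by rw [sum_down, sum_comp_rev fun i => g (x i)]

theorem down_nonneg {x : Fin m → ℝ} (h : ∀ i, 0 ≤ x i) (i : Fin m) : 0 ≤ down x i := h _

theorem up_nonneg {x : Fin m → ℝ} (h : ∀ i, 0 ≤ x i) (i : Fin m) : 0 ≤ up x i := h _

theorem majorizedSame_of_sum_posPart_le {x y : Fin m → ℝ}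
    (h : ∀ l, ∑ i, max (x i - down y l) 0 ≤ ∑ i, max (y i - down y l) 0)
    (hs : ∑ i, x i = ∑ i, y i) : MajorizedSame x y := by
  refine ⟨fun l => sum_Iic_le_of_sum_posPart_le (antitone_down y) l ?_, hs⟩
  rw [sum_down (fun s => max (s - down y l) 0) x, sum_down (fun s => max (s - down y l) 0) y]
  exact h l

end Rearrangement

/-! ### Completion with zeros -/

section Pad

variable {k m : ℕ}

theorem sum_pad (hk : k ≤ m) (g : ℝ → ℝ) (x : Fin k → ℝ) :
    ∑ i, g (pad m x i) = ∑ i, g (x i) + ((m - k : ℕ) : ℝ) * g 0 := by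
  obtain ⟨r, rfl⟩ := Nat.exists_eq_add_of_le hk
  rw [Fin.sum_univ_add]
  simp [pad]

theorem sum_pad_of_eq_zero (hk : k ≤ m) {g : ℝ → ℝ} (hg : g 0 = 0) (x : Fin k → ℝ) :
    ∑ i, g (pad m x i) = ∑ i, g (x i) := by
  rw [sum_pad hk, hg, mul_zero, add_zero]

theorem pad_nonneg {x : Fin k → ℝ} (h : ∀ i, 0 ≤ x i) (i : Fin m) : 0 ≤ pad m x i := by
  unfold pad
  split_ifs
  exacts [h _, le_rfl]

theorem antitone_pad {x : Fin k → ℝ} (h : ∀ i, 0 ≤ x i) (hx : Antitone x) :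
    Antitone (pad m x) := by
  intro i j hij
  unfold pad
  have hij' : (i : ℕ) ≤ j := hij
  split_ifs with h1 h2 h2
  · exact hx hij'
  · omega
  · exact h _
  · exact le_rfl

/-- Nonnegativity is what keeps the appended zeros at the end after sorting. -/
theorem down_pad (hk : k ≤ m) {x : Fin k → ℝ} (h : ∀ i, 0 ≤ x i) :
    down (pad m x) = pad m (down x) :=
  eq_of_antitone_of_sum_comp_eq (antitone_down _)
    (antitone_pad (down_nonneg h) (antitone_down x)) fun g => by
      rw [sum_down, sum_pad hk, sum_pad hk, sum_down]

theorem sum_Iic_pad (hk : k ≤ m) (x : Fin k → ℝ) (l : Fin m) :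
    ∑ i ∈ Iic l, pad m x i = ∑ i with ((i : Fin k) : ℕ) ≤ (l : ℕ), x i := by
  obtain ⟨r, rfl⟩ := Nat.exists_eq_add_of_le hk
  have h1 : Iic l = univ.filter fun i : Fin (k + r) => (i : ℕ) ≤ (l : ℕ) :=
    Finset.ext fun i => by
      rw [mem_Iic, mem_filter]
      exact ⟨fun h => ⟨mem_univ _, h⟩, fun h => h.2⟩
  rw [h1, sum_filter, Fin.sum_univ_add, sum_filter]
  simp [pad]

end Pad

/-! ### Majorization through T-transforms, and Karamata's inequality -/

section MajorizationInduction

variable {m : ℕ}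

/-- Hardy–Littlewood–Pólya: each T-transform applied to `y` makes one more coordinate equal to that
of `x`, so the number of disagreements is the induction variable. -/
theorem induction_of_sum_Iic_le {P : (Fin m → ℝ) → Prop}
    (hT : ∀ (z : Fin m → ℝ) (i j : Fin m) (δ : ℝ), i ≠ j → 0 ≤ δ → δ ≤ z i - z j → P z →
      P (z - Pi.single i δ + Pi.single j δ))
    {x : Fin m → ℝ} (hx : Antitone x) (n : ℕ) :
    ∀ y : Fin m → ℝ, #{i | x i ≠ y i} = n →
      (∀ l, ∑ i ∈ Iic l, x i ≤ ∑ i ∈ Iic l, y i) → ∑ i, x i = ∑ i, y i → P y → P x := by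
  induction n using Nat.strong_induction_on with
  | _ n ih =>
  intro y hn hxy hs hy
  by_cases hle : ∀ i, x i ≤ y i
  · have : x = y := funext fun i =>
      (sum_eq_sum_iff_of_le (fun i _ => hle i)).1 hs i (mem_univ i)
    rwa [this]
  push Not at hle
  obtain ⟨q, hq, hqmin⟩ := WellFounded.has_min (wellFounded_lt (α := Fin m)) {i | y i < x i} hle
  have hlt : ∀ i < q, x i ≤ y i := fun i hi => not_lt.1 fun h => hqmin i h hi
  have hp : ∃ p < q, x p < y p := by
    by_contra! hcon
    have h1 := hxy q
    rw [← Iio_insert, sum_insert (by simp), sum_insert (by simp),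
      sum_congr rfl fun i hi => le_antisymm (hlt i (mem_Iio.1 hi)) (hcon i (mem_Iio.1 hi))] at h1
    have hq' : y q < x q := hq
    linarith
  obtain ⟨p, hpq, hp⟩ := hp
  have hq' : y q < x q := hq
  -- The largest transfer that overshoots `x` at neither `p` nor `q`; it settles one of them.
  set δ := min (y p - x p) (x q - y q) with hδ
  have hδp : δ ≤ y p - x p := min_le_left _ _
  have hδq : δ ≤ x q - y q := min_le_right _ _
  have hδ0 : 0 < δ := lt_min (by linarith) (by linarith)
  set y' : Fin m → ℝ := y - Pi.single p δ + Pi.single q δ with hy'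
  have hy'p : y' p = y p - δ := by simp [hy', hpq.ne]
  have hy'q : y' q = y q + δ := by simp [hy', hpq.ne']
  have hy'i : ∀ i, i ≠ p → i ≠ q → y' i = y i := fun i h1 h2 => by simp [hy', h1, h2]
  have hsum : ∀ s : Finset (Fin m), ∑ i ∈ s, y' i
      = ∑ i ∈ s, y i - (if p ∈ s then δ else 0) + (if q ∈ s then δ else 0) := fun s => by
    simp [hy', sum_add_distrib, sum_sub_distrib]
  refine ih #{i | x i ≠ y' i} ?_ y' rfl ?_ ?_ ?_
  · rw [← hn]
    apply card_lt_card
    rw [Finset.ssubset_iff_of_subset]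
    · rcases min_choice (y p - x p) (x q - y q) with h | h
      · exact ⟨p, by simp [hp.ne], by simp [hy'p, hδ, h]⟩
      · exact ⟨q, by simp [hq'.ne'], by simp [hy'q, hδ, h]⟩
    · intro i hi
      simp only [mem_filter, mem_univ, true_and] at hi ⊢
      rcases eq_or_ne i p with rfl | h1
      · exact hp.ne
      rcases eq_or_ne i q with rfl | h2
      · exact hq'.ne'
      rwa [hy'i i h1 h2] at hi
  · intro l
    rw [hsum]
    by_cases hql : q ≤ l
    · simpa [hql, hpq.le.trans hql] using hxy l
    · by_cases hpl : p ≤ l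
      -- Only prefixes containing `p` but not `q` lose `δ`. Before `q` every term `y i - x i` is
      -- nonnegative, so the one at `p` alone supplies the slack.
      · have h1 : y p - x p ≤ ∑ i ∈ Iic l, (y i - x i) :=
          single_le_sum (f := fun i => y i - x i)
            (fun i hi => sub_nonneg.2 (hlt i ((mem_Iic.1 hi).trans_lt (not_le.1 hql))))
            (mem_Iic.2 hpl)
        rw [sum_sub_distrib] at h1
        simp only [mem_Iic, hpl, hql, if_true, if_false]
        linarith
      · simpa [hpl, hql] using hxy l
  · rw [hsum]
    simpa using hs
  · refine hT y p q δ hpq.ne hδ0.le ?_ hy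
    have := hx hpq.le
    linarith

/-- A property invariant under permutations and `T`-transforms passes to majorized vectors. -/
theorem MajorizedSame.induction {P : (Fin m → ℝ) → Prop}
    (hperm : ∀ (z : Fin m → ℝ) (σ : Equiv.Perm (Fin m)), P z → P (z ∘ σ))
    (hT : ∀ (z : Fin m → ℝ) (i j : Fin m) (δ : ℝ), i ≠ j → 0 ≤ δ → δ ≤ z i - z j → P z →
      P (z - Pi.single i δ + Pi.single j δ))
    {x y : Fin m → ℝ} (h : MajorizedSame x y) (hy : P y) : P x := by
  obtain ⟨σ, hσ⟩ := down_eq_comp_perm y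
  obtain ⟨τ, hτ⟩ := down_eq_comp_perm x
  have h1 : P (down x) := by
    refine induction_of_sum_Iic_le hT (antitone_down x) _ (down y) rfl h.1 ?_ ?_
    · exact (sum_down id x).trans (h.2.trans (sum_down id y).symm)
    · rw [hσ]
      exact hperm y σ hy
  have h2 := hperm _ τ⁻¹ h1
  rw [hτ] at h2
  convert h2 using 1
  ext i
  simp

theorem convexOn_add_le {f : ℝ → ℝ} (hf : ConvexOn ℝ (Set.Ici 0) f) {p q δ : ℝ} (hq : 0 ≤ q)
    (h0 : 0 ≤ δ) (h1 : δ ≤ p - q) : f (p - δ) + f (q + δ) ≤ f p + f q := by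
  rcases h0.eq_or_lt with rfl | h0
  · simp
  have hpq : 0 < p - q := h0.trans_le h1
  have hp : 0 ≤ p := by linarith
  set t := δ / (p - q) with ht
  have htδ : t * (p - q) = δ := div_mul_cancel₀ _ hpq.ne'
  have ht0 : 0 ≤ t := by positivity
  have ht1 : t ≤ 1 := (div_le_one hpq).2 h1
  have e1 := hf.2 (x := p) (y := q) hp hq (sub_nonneg.2 ht1) ht0 (by ring)
  have e2 := hf.2 (x := p) (y := q) hp hq ht0 (sub_nonneg.2 ht1) (by ring)
  simp only [smul_eq_mul] at e1 e2
  rw [show (1 - t) * p + t * q = p - δ by rw [← htδ]; ring] at e1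
  rw [show t * p + (1 - t) * q = q + δ by rw [← htδ]; ring] at e2
  linarith

theorem strictConvexOn_add_lt {f : ℝ → ℝ} (hf : StrictConvexOn ℝ (Set.Ici 0) f) {p q δ : ℝ}
    (hq : 0 ≤ q) (h0 : 0 < δ) (h1 : δ < p - q) : f (p - δ) + f (q + δ) < f p + f q := by
  have hpq : 0 < p - q := h0.trans h1
  have hp : 0 ≤ p := by linarith
  set t := δ / (p - q) with ht
  have htδ : t * (p - q) = δ := div_mul_cancel₀ _ hpq.ne'
  have ht0 : 0 < t := by positivity
  have ht1 : t < 1 := (div_lt_one hpq).2 h1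
  have hne : p ≠ q := fun h => by linarith
  have e1 := hf.2 (x := p) (y := q) hp hq hne (sub_pos.2 ht1) ht0 (by ring)
  have e2 := hf.2 (x := p) (y := q) hp hq hne ht0 (sub_pos.2 ht1) (by ring)
  simp only [smul_eq_mul] at e1 e2
  rw [show (1 - t) * p + t * q = p - δ by rw [← htδ]; ring] at e1
  rw [show t * p + (1 - t) * q = q + δ by rw [← htδ]; ring] at e2
  linarith

theorem sumF_transfer (f : ℝ → ℝ) (z : Fin m → ℝ) {i j : Fin m} (hij : i ≠ j) (δ : ℝ) :
    sumF f (z - Pi.single i δ + Pi.single j δ) + (f (z i) + f (z j))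
      = sumF f z + (f (z i - δ) + f (z j + δ)) := by
  have h : ∀ y : Fin m → ℝ, sumF f y = f (y i) + f (y j) + ∑ l ∈ (univ.erase i).erase j, f (y l) :=
    fun y => by
      rw [sumF, ← add_sum_erase _ _ (mem_univ i),
        ← add_sum_erase (univ.erase i) _ (mem_erase.2 ⟨hij.symm, mem_univ j⟩), add_assoc]
  rw [h, h z, sum_congr rfl (g := fun l => f (z l))]
  · simp only [Pi.add_apply, Pi.sub_apply, Pi.single_eq_same, Pi.single_eq_of_ne hij,
      Pi.single_eq_of_ne hij.symm]
    ring_nf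
  · intro l hl
    simp only [mem_erase, mem_univ, and_true] at hl
    simp [Pi.single_eq_of_ne hl.1, Pi.single_eq_of_ne hl.2]

theorem sumF_comp_perm (f : ℝ → ℝ) (z : Fin m → ℝ) (σ : Equiv.Perm (Fin m)) :
    sumF f (z ∘ σ) = sumF f z :=
  Equiv.sum_comp σ fun i => f (z i)

theorem sumF_down (f : ℝ → ℝ) (z : Fin m → ℝ) : sumF f (down z) = sumF f z := sum_down f z

/-- Karamata's inequality. -/
theorem sumF_le_of_majorizedSame {f : ℝ → ℝ} (hf : ConvexOn ℝ (Set.Ici 0) f) {x y : Fin m → ℝ}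
    (hy : ∀ i, 0 ≤ y i) (h : MajorizedSame x y) : sumF f x ≤ sumF f y := by
  refine (h.induction (P := fun z => (∀ i, 0 ≤ z i) ∧ sumF f z ≤ sumF f y) ?_ ?_
    ⟨hy, le_rfl⟩).2
  · rintro z σ ⟨h1, h2⟩
    exact ⟨fun i => h1 _, by rwa [sumF_comp_perm]⟩
  · rintro z i j δ hij h0 h1 ⟨hz, h2⟩
    refine ⟨fun l => ?_, ?_⟩
    · rcases eq_or_ne l i with rfl | hi
      · have := hz j
        simp only [Pi.add_apply, Pi.sub_apply, Pi.single_eq_same, Pi.single_eq_of_ne hij]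
        linarith
      · have h3 : 0 ≤ (Pi.single j δ : Fin m → ℝ) l := by
          rw [Pi.single_apply]
          split_ifs <;> linarith
        have := hz l
        simp only [Pi.add_apply, Pi.sub_apply, Pi.single_eq_of_ne hi]
        linarith
    · have e1 := sumF_transfer f z hij δ
      have e2 := convexOn_add_le hf (hz j) h0 h1
      linarith

theorem sumF_midpoint_lt {f : ℝ → ℝ} (hf : StrictConvexOn ℝ (Set.Ici 0) f) {x y : Fin m → ℝ}
    (hx : ∀ i, 0 ≤ x i) (hy : ∀ i, 0 ≤ y i) (hxy : x ≠ y) :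
    sumF f (fun i => (1 / 2) * x i + (1 / 2) * y i) < (1 / 2) * sumF f x + (1 / 2) * sumF f y := by
  obtain ⟨i, hi⟩ := Function.ne_iff.1 hxy
  simp only [sumF, mul_sum, ← sum_add_distrib]
  refine sum_lt_sum (fun j _ => ?_) ⟨i, mem_univ i, ?_⟩
  · exact hf.convexOn.2 (hx j) (hy j) (by norm_num) (by norm_num) (by norm_num)
  · exact hf.2 (hx i) (hy i) hi (by norm_num) (by norm_num) (by norm_num)

/-- The equality case of Karamata's inequality. -/
theorem down_eq_of_majorizedSame_of_sumF_le {f : ℝ → ℝ} (hf : StrictConvexOn ℝ (Set.Ici 0) f)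
    {x y : Fin m → ℝ} (hx : ∀ i, 0 ≤ x i) (hy : ∀ i, 0 ≤ y i) (h : MajorizedSame x y)
    (hle : sumF f y ≤ sumF f x) : down x = down y := by
  by_contra hne
  have h1 := sumF_midpoint_lt hf (down_nonneg hx) (down_nonneg hy) hne
  rw [sumF_down, sumF_down] at h1
  -- The midpoint of the sorted vectors still majorizes `x`, yet strict convexity puts its sum below
  -- the average, contradicting Karamata.
  set z : Fin m → ℝ := fun i => (1 / 2) * down x i + (1 / 2) * down y i with hz
  have hza : Antitone z := fun i j hij => by
    have e1 := antitone_down x hij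
    have e2 := antitone_down y hij
    simp only [hz]
    linarith
  have h2 : MajorizedSame x z := by
    refine ⟨fun l => ?_, ?_⟩
    · rw [down_eq_self hza]
      simp only [hz, sum_add_distrib, ← mul_sum]
      have := h.1 l
      linarith
    · simp only [hz, sum_add_distrib, ← mul_sum]
      have e1 := sum_down id x
      have e2 := sum_down id y
      simp only [id] at e1 e2
      rw [e1, e2, ← h.2]
      ring
  have h3 := sumF_le_of_majorizedSame hf.convexOn
    (fun i => by
      have e1 := down_nonneg hx i
      have e2 := down_nonneg hy i
      simp only [hz]
      linarith) h2
  linarith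

end MajorizationInduction

end FrameCompletion

end

/-! ### Eigenvalue inequalities for Hermitian matrices -/

noncomputable section

namespace FrameCompletion

open Finset Matrix

variable {d : ℕ}

/-- The real quadratic form of a complex matrix. -/
def quad (A : Matrix (Fin d) (Fin d) ℂ) (x : Fin d → ℂ) : ℝ := (star x ⬝ᵥ A *ᵥ x).re

theorem quad_add (A B : Matrix (Fin d) (Fin d) ℂ) (x : Fin d → ℂ) :
    quad (A + B) x = quad A x + quad B x := by
  simp [quad, add_mulVec, dotProduct_add]

theorem quad_sub (A B : Matrix (Fin d) (Fin d) ℂ) (x : Fin d → ℂ) :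
    quad (A - B) x = quad A x - quad B x := by
  simp [quad, sub_mulVec, dotProduct_sub]

theorem quad_sum {ι : Type*} (s : Finset ι) (A : ι → Matrix (Fin d) (Fin d) ℂ) (x : Fin d → ℂ) :
    quad (∑ i ∈ s, A i) x = ∑ i ∈ s, quad (A i) x := by
  simp [quad, sum_mulVec, dotProduct_sum]

theorem quad_vecMulVec_star (g x : Fin d → ℂ) :
    quad (vecMulVec g (star g)) x = Complex.normSq (star g ⬝ᵥ x) := by
  have h : star x ⬝ᵥ g = star (star g ⬝ᵥ x) := by
    rw [star_dotProduct]
  rw [quad, vecMulVec_mulVec, dotProduct_smul, h]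
  simp [Complex.normSq_apply]

/-- The Hermitian matrix with eigenvalues `α` and eigenvectors the columns of `U`. -/
def conjDiag (U : Matrix (Fin d) (Fin d) ℂ) (α : Fin d → ℝ) : Matrix (Fin d) (Fin d) ℂ :=
  U * diagonal (fun i => (α i : ℂ)) * star U

theorem conjDiag_isHermitian (U : Matrix (Fin d) (Fin d) ℂ) (α : Fin d → ℝ) :
    (conjDiag U α).IsHermitian := by
  have h : (diagonal fun i => (α i : ℂ)).IsHermitian :=
    isHermitian_diagonal_of_self_adjoint _ (by ext i; simp)
  rw [conjDiag, star_eq_conjTranspose]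
  exact isHermitian_mul_mul_conjTranspose U h

theorem conjDiag_add (U : Matrix (Fin d) (Fin d) ℂ) (α β : Fin d → ℝ) :
    conjDiag U α + conjDiag U β = conjDiag U (α + β) := by
  rw [conjDiag, conjDiag, conjDiag, ← add_mul, ← mul_add, diagonal_add]
  simp

theorem conjDiag_const {U : Matrix (Fin d) (Fin d) ℂ} (hU : U * star U = 1) (t : ℝ) :
    conjDiag U (fun _ => t) = (t : ℂ) • 1 := by
  rw [conjDiag, ← smul_one_eq_diagonal]
  simp [hU]

theorem quad_conjDiag (U : Matrix (Fin d) (Fin d) ℂ) (α : Fin d → ℝ) (x : Fin d → ℂ) :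
    quad (conjDiag U α) x = ∑ i, α i * Complex.normSq ((star U *ᵥ x) i) := by
  have h : star x ᵥ* U = star (star U *ᵥ x) := by
    rw [star_mulVec, star_eq_conjTranspose, conjTranspose_conjTranspose]
  rw [quad, conjDiag, ← mulVec_mulVec, ← mulVec_mulVec, dotProduct_mulVec, h]
  simp only [dotProduct, mulVec_diagonal, Complex.re_sum]
  refine sum_congr rfl fun i _ => ?_
  simp [Complex.normSq_apply]
  ring

theorem sum_normSq_star_mulVec {U : Matrix (Fin d) (Fin d) ℂ} (hU : U * star U = 1)
    (x : Fin d → ℂ) : ∑ i, Complex.normSq ((star U *ᵥ x) i) = ∑ i, Complex.normSq (x i) := by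
  have h := quad_conjDiag U (fun _ => 1) x
  have h1 := quad_conjDiag (1 : Matrix (Fin d) (Fin d) ℂ) (fun _ => 1) x
  rw [conjDiag_const hU] at h
  rw [conjDiag_const (by simp)] at h1
  simpa using h.symm.trans h1

theorem conjDiag_comp_perm (U : Matrix (Fin d) (Fin d) ℂ) (α : Fin d → ℝ)
    (σ : Equiv.Perm (Fin d)) : conjDiag (U.submatrix id σ) (α ∘ σ) = conjDiag U α := by
  have h : diagonal (fun i => ((α ∘ σ) i : ℂ)) = (diagonal fun i => (α i : ℂ)).submatrix σ σ := by
    rw [submatrix_diagonal_equiv]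
    rfl
  rw [conjDiag, conjDiag, h, star_eq_conjTranspose, star_eq_conjTranspose, conjTranspose_submatrix,
    submatrix_mul_equiv, submatrix_mul_equiv, submatrix_id_id]

theorem exists_conjDiag_comp_perm {A : Matrix (Fin d) (Fin d) ℂ} (hA : A.IsHermitian)
    (σ : Equiv.Perm (Fin d)) : ∃ U : Matrix (Fin d) (Fin d) ℂ, U * star U = 1 ∧
      A = conjDiag U (hA.eigenvalues ∘ σ) := by
  refine ⟨(hA.eigenvectorUnitary : Matrix (Fin d) (Fin d) ℂ).submatrix id σ, ?_, ?_⟩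
  · rw [star_eq_conjTranspose, conjTranspose_submatrix, submatrix_mul_equiv, submatrix_id_id,
      ← star_eq_conjTranspose]
    exact Unitary.coe_mul_star_self _
  · rw [conjDiag_comp_perm]
    conv_lhs => rw [hA.spectral_theorem, Unitary.conjStarAlgAut_apply]
    rfl

theorem exists_conjDiag_down {A : Matrix (Fin d) (Fin d) ℂ} (hA : A.IsHermitian) :
    ∃ U : Matrix (Fin d) (Fin d) ℂ, U * star U = 1 ∧ A = conjDiag U (down hA.eigenvalues) := by
  obtain ⟨σ, hσ⟩ := down_eq_comp_perm hA.eigenvalues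
  rw [hσ]
  exact exists_conjDiag_comp_perm hA σ

theorem exists_conjDiag_up {A : Matrix (Fin d) (Fin d) ℂ} (hA : A.IsHermitian) :
    ∃ U : Matrix (Fin d) (Fin d) ℂ, U * star U = 1 ∧ A = conjDiag U (up hA.eigenvalues) :=
  exists_conjDiag_comp_perm hA _

open Polynomial in
-- The roots of the characteristic polynomial determine the eigenvalues as a multiset; quantifying
-- over `g` records that multiset without choosing an ordering.
theorem sum_eigenvalues_conjDiag {U : Matrix (Fin d) (Fin d) ℂ} (hU : U * star U = 1)
    (α : Fin d → ℝ) (hA : (conjDiag U α).IsHermitian) (g : ℝ → ℝ) :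
    ∑ i, g (hA.eigenvalues i) = ∑ i, g (α i) := by
  have h1 : (conjDiag U α).charpoly = ∏ i, (X - C (α i : ℂ)) := by
    rw [conjDiag, charpoly_mul_comm, ← mul_assoc, mul_eq_one_comm.1 hU, one_mul, charpoly_diagonal]
  have h2 : (conjDiag U α).charpoly.roots = Multiset.map (fun i => (α i : ℂ)) univ.val := by
    rw [h1, roots_prod _ _ (prod_ne_zero_iff.2 fun i _ => X_sub_C_ne_zero _)]
    simp
  rw [hA.roots_charpoly_eq_eigenvalues] at h2
  have h3 := congrArg (fun s => (Multiset.map (fun z : ℂ => g z.re) s).sum) h2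
  simpa [Multiset.map_map, Function.comp_def, List.sum_ofFn] using h3

theorem down_eigenvalues_conjDiag {U : Matrix (Fin d) (Fin d) ℂ} (hU : U * star U = 1)
    {α : Fin d → ℝ} (hα : Antitone α) (hA : (conjDiag U α).IsHermitian) :
    down hA.eigenvalues = α := by
  rw [down_eq_down (sum_eigenvalues_conjDiag hU α hA), down_eq_self hα]

theorem trace_re_eq_sum_eigenvalues {A : Matrix (Fin d) (Fin d) ℂ} (hA : A.IsHermitian) :
    (trace A).re = ∑ i, hA.eigenvalues i := by
  rw [hA.trace_eq_sum_eigenvalues]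
  simp

/-- Weyl's monotonicity principle. -/
theorem down_eigenvalues_mono {A B : Matrix (Fin d) (Fin d) ℂ} (hA : A.IsHermitian)
    (hB : B.IsHermitian) (h : ∀ x, quad A x ≤ quad B x) (i : Fin d) :
    down hA.eigenvalues i ≤ down hB.eigenvalues i := by
  obtain ⟨U, hU, hAU⟩ := exists_conjDiag_down hA
  obtain ⟨V, hV, hBV⟩ := exists_conjDiag_down hB
  have hα := antitone_down hA.eigenvalues
  have hβ := antitone_down hB.eigenvalues
  set α := down hA.eigenvalues
  set β := down hB.eigenvalues
  -- These d − 1 conditions kill the components along the eigenvectors of `A` after `i` and of `B`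
  -- before `i`. A nonzero vector survives, and it compares `α i` with `β i`.
  let L : (Fin d → ℂ) →ₗ[ℂ] ({j : Fin d // j ≠ i} → ℂ) :=
    LinearMap.pi fun j => if (i : Fin d) < j then
      LinearMap.proj (j : Fin d) ∘ₗ (star U).mulVecLin
      else LinearMap.proj (j : Fin d) ∘ₗ (star V).mulVecLin
  have hker : LinearMap.ker L ≠ ⊥ := by
    apply LinearMap.ker_ne_bot_of_finrank_lt
    rw [Module.finrank_fintype_fun_eq_card, Module.finrank_fintype_fun_eq_card,
      Fintype.card_subtype_compl]
    have := i.pos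
    simp
    omega
  obtain ⟨x, hxL, hx0⟩ := Submodule.exists_mem_ne_zero_of_ne_bot hker
  have hx : ∀ j : {j : Fin d // j ≠ i}, L x j = 0 := fun j => by
    rw [LinearMap.mem_ker.1 hxL]
    rfl
  have hxU : ∀ j, i < j → (star U *ᵥ x) j = 0 := fun j hj => by
    simpa [L, hj] using hx ⟨j, hj.ne'⟩
  have hxV : ∀ j, j < i → (star V *ᵥ x) j = 0 := fun j hj => by
    simpa [L, hj.not_gt] using hx ⟨j, hj.ne⟩
  set N := ∑ j, Complex.normSq (x j) with hN
  have hNpos : 0 < N := by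
    obtain ⟨j, hj⟩ := Function.ne_iff.1 hx0
    exact sum_pos' (fun j _ => Complex.normSq_nonneg _) ⟨j, mem_univ j, Complex.normSq_pos.2 hj⟩
  have h1 : α i * N ≤ quad A x := by
    rw [hAU, quad_conjDiag, hN, ← sum_normSq_star_mulVec hU, mul_sum]
    refine sum_le_sum fun j _ => ?_
    rcases le_or_gt j i with hj | hj
    · exact mul_le_mul_of_nonneg_right (hα hj) (Complex.normSq_nonneg _)
    · simp [hxU j hj]
  have h2 : quad B x ≤ β i * N := by
    rw [hBV, quad_conjDiag, hN, ← sum_normSq_star_mulVec hV, mul_sum]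
    refine sum_le_sum fun j _ => ?_
    rcases lt_or_ge j i with hj | hj
    · simp [hxV j hj]
    · exact mul_le_mul_of_nonneg_right (hβ hj) (Complex.normSq_nonneg _)
  exact le_of_mul_le_mul_right ((h1.trans (h x)).trans h2) hNpos

/-- Lidskii's inequality, in terms of positive parts. -/
theorem sum_posPart_down_add_up_le {A B C : Matrix (Fin d) (Fin d) ℂ} (hA : A.IsHermitian)
    (hB : B.IsHermitian) (hC : C.IsHermitian) (hABC : C = A + B) (t : ℝ) :
    ∑ i, max (down hA.eigenvalues i + up hB.eigenvalues i - t) 0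
      ≤ ∑ i, max (hC.eigenvalues i - t) 0 := by
  obtain ⟨W, hW, hCW⟩ := exists_conjDiag_down hC
  obtain ⟨V, hV, hBV⟩ := exists_conjDiag_up hB
  set c := down hC.eigenvalues with hc
  set b := up hB.eigenvalues with hb
  -- Clipping the spectrum of `C` below at `t` gives P ≥ C and P ≥ t, so P − B dominates both `A`
  -- and t − B. By Weyl its eigenvalues bound both terms of each positive part, and the trace of `P`
  -- evaluates the sum.
  set P := conjDiag W fun i => max (c i) t with hP
  have hPherm : P.IsHermitian := conjDiag_isHermitian _ _
  have hA' : (P - B).IsHermitian := hPherm.sub hB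
  have hX := conjDiag_isHermitian V fun i => t - b i
  have hXB : conjDiag V (fun i => t - b i) + B = (t : ℂ) • 1 := by
    rw [hBV, conjDiag_add, ← conjDiag_const hV]
    congr 1
    ext i
    simp
  have h1 : ∀ i, down hA.eigenvalues i ≤ down hA'.eigenvalues i := by
    refine down_eigenvalues_mono hA hA' fun x => ?_
    have e1 : quad C x ≤ quad P x := by
      rw [hCW, hP, quad_conjDiag, quad_conjDiag]
      exact sum_le_sum fun i _ =>
        mul_le_mul_of_nonneg_right (le_max_left _ _) (Complex.normSq_nonneg _)
    rw [hABC, quad_add] at e1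
    rw [quad_sub]
    linarith
  have h2 : ∀ i, t - b i ≤ down hA'.eigenvalues i := fun i => by
    have e0 : Antitone fun i => t - b i := fun i j hij =>
      sub_le_sub_left (monotone_up hB.eigenvalues hij) t
    have e1 := down_eigenvalues_mono hX hA' (fun x => ?_) i
    · rwa [down_eigenvalues_conjDiag hV e0 hX] at e1
    have e2 : quad (conjDiag W fun _ => t) x ≤ quad P x := by
      rw [hP, quad_conjDiag, quad_conjDiag]
      exact sum_le_sum fun i _ =>
        mul_le_mul_of_nonneg_right (le_max_right _ _) (Complex.normSq_nonneg _)
    rw [conjDiag_const hW, ← hXB, quad_add] at e2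
    rw [quad_sub]
    linarith
  have h3 : ∑ i, down hA'.eigenvalues i + ∑ i, b i = ∑ i, max (c i) t := by
    have e1 := sum_down id hA'.eigenvalues
    have e2 := sum_up id hB.eigenvalues
    have e3 := sum_eigenvalues_conjDiag hW (fun i => max (c i) t) hPherm id
    simp only [id] at e1 e2 e3
    rw [e1, hb, e2, ← trace_re_eq_sum_eigenvalues, ← trace_re_eq_sum_eigenvalues, ← e3,
      ← trace_re_eq_sum_eigenvalues hPherm]
    simp
  calc ∑ i, max (down hA.eigenvalues i + b i - t) 0
      ≤ ∑ i, (down hA'.eigenvalues i + b i - t) := sum_le_sum fun i _ =>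
        max_le (by linarith [h1 i]) (by linarith [h2 i])
    _ = ∑ i, (max (c i) t - t) := by
        rw [sum_sub_distrib, sum_add_distrib, h3, sum_sub_distrib]
    _ = ∑ i, max (c i - t) 0 := sum_congr rfl fun i _ => by
        rw [← max_sub_sub_right, sub_self]
    _ = ∑ i, max (hC.eigenvalues i - t) 0 := sum_down (fun s => max (s - t) 0) hC.eigenvalues

theorem majorizedSame_down_add_up {A B C : Matrix (Fin d) (Fin d) ℂ} (hA : A.IsHermitian)
    (hB : B.IsHermitian) (hC : C.IsHermitian) (hABC : C = A + B) :
    MajorizedSame (down hA.eigenvalues + up hB.eigenvalues) (down hC.eigenvalues) := by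
  refine majorizedSame_of_sum_posPart_le (fun l => ?_) ?_
  · rw [sum_down fun s => max (s - _) 0]
    exact sum_posPart_down_add_up_le hA hB hC hABC _
  · have e1 := sum_down id hA.eigenvalues
    have e2 := sum_up id hB.eigenvalues
    have e3 := sum_down id hC.eigenvalues
    simp only [id] at e1 e2 e3
    simp only [Pi.add_apply]
    rw [sum_add_distrib, e1, e2, e3, ← trace_re_eq_sum_eigenvalues, ← trace_re_eq_sum_eigenvalues,
      ← trace_re_eq_sum_eigenvalues, hABC]
    simp

theorem eigenvalues_nonneg_of_quad {A : Matrix (Fin d) (Fin d) ℂ} (hA : A.IsHermitian)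
    (h : ∀ x, 0 ≤ quad A x) (i : Fin d) : 0 ≤ hA.eigenvalues i := by
  rw [hA.eigenvalues_eq]
  exact h _

end FrameCompletion

end

/-! ### Frame operators: Schur's majorization -/

noncomputable section

namespace FrameCompletion

open Finset Matrix

variable {d : ℕ}

section Frames

variable {k n₀ : ℕ}

theorem trace_vecMulVec_star_re (g : EuclideanSpace ℂ (Fin d)) :
    (trace (vecMulVec g.ofLp (star g.ofLp))).re = ‖g‖ ^ 2 := by
  rw [trace_vecMulVec, EuclideanSpace.norm_sq_eq, dotProduct, Complex.re_sum]
  refine sum_congr rfl fun i _ => ?_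
  rw [← Complex.normSq_eq_norm_sq, Complex.normSq_apply]
  simp

theorem trace_frameOp_re (G : Fin k → EuclideanSpace ℂ (Fin d)) :
    (trace (frameOp G)).re = ∑ i, ‖G i‖ ^ 2 := by
  rw [frameOp, trace_sum, Complex.re_sum]
  exact sum_congr rfl fun i _ => trace_vecMulVec_star_re _

theorem quad_frameOp (G : Fin k → EuclideanSpace ℂ (Fin d)) (x : Fin d → ℂ) :
    quad (frameOp G) x = ∑ i, Complex.normSq (star (G i).ofLp ⬝ᵥ x) := by
  rw [frameOp, quad_sum]
  exact sum_congr rfl fun i _ => quad_vecMulVec_star _ _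

theorem eigenvalues_frameOp_nonneg (G : Fin k → EuclideanSpace ℂ (Fin d)) (i : Fin d) :
    0 ≤ (frameOp_isHermitian G).eigenvalues i :=
  eigenvalues_nonneg_of_quad _ (fun x => by
    rw [quad_frameOp]
    exact sum_nonneg fun i _ => Complex.normSq_nonneg _) i

theorem eigDown_nonneg (G : Fin k → EuclideanSpace ℂ (Fin d)) (i : Fin d) : 0 ≤ eigDown G i :=
  down_nonneg (eigenvalues_frameOp_nonneg G) i

theorem eigUp_nonneg (G : Fin k → EuclideanSpace ℂ (Fin d)) (i : Fin d) : 0 ≤ eigUp G i :=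
  up_nonneg (eigenvalues_frameOp_nonneg G) i

theorem frameOp_completion {F₀ : Fin n₀ → EuclideanSpace ℂ (Fin d)} {a : Fin k → ℝ}
    {F : Fin (n₀ + k) → EuclideanSpace ℂ (Fin d)} (hF : F ∈ completions F₀ a) :
    frameOp F = frameOp F₀ + frameOp (added F) := by
  rw [frameOp, Fin.sum_univ_add]
  simp only [hF.1]
  rfl

theorem potential_eq_sumF (f : ℝ → ℝ) (G : Fin k → EuclideanSpace ℂ (Fin d)) :
    potential f G = sumF f (eigDown G) := by
  have h := frameOp_isHermitian G
  rw [eigDown, sumF_down, potential, h.cfc_eq, IsHermitian.cfc, Unitary.conjStarAlgAut_apply,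
    trace_mul_cycle, Unitary.coe_star_mul_self, one_mul, trace_diagonal]
  simp [sumF]

theorem rank_frameOp_le (G : Fin k → EuclideanSpace ℂ (Fin d)) (s : Finset (Fin k))
    (hG : ∀ i ∉ s, G i = 0) : (frameOp G).rank ≤ #s := by
  let M : Matrix (Fin d) s ℂ := of fun r i => G i r
  have h : frameOp G = M * Mᴴ := by
    ext r c
    rw [frameOp, Matrix.sum_apply, mul_apply, ← sum_subset (subset_univ s), ← sum_coe_sort s]
    · simp [M, vecMulVec_apply]
    · intro i _ hi
      simp [hG i hi, vecMulVec_apply]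
  rw [h]
  refine (rank_mul_le_left M Mᴴ).trans ((rank_le_card_width M).trans ?_)
  simp

/-- The Schur majorization `(‖g_i‖²) ≺ λ(S_G)`, in terms of positive parts. -/
theorem sum_posPart_norm_sq_le (G : Fin k → EuclideanSpace ℂ (Fin d)) {t : ℝ} (ht : 0 ≤ t) :
    ∑ i, max (‖G i‖ ^ 2 - t) 0 ≤ ∑ j, max ((frameOp_isHermitian G).eigenvalues j - t) 0 := by
  classical
  -- Discarding the vectors with squared norm at most `t` leaves an operator of rank at most #s
  -- below S_G. Its trace minus `t` times its rank is at most the sum of the positive parts of its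
  -- eigenvalues.
  set s : Finset (Fin k) := {i | t < ‖G i‖ ^ 2} with hs
  let G' : Fin k → EuclideanSpace ℂ (Fin d) := fun i => if i ∈ s then G i else 0
  have hG' := frameOp_isHermitian G'
  have hrank : (frameOp G').rank ≤ #s := rank_frameOp_le G' s fun i hi => by simp [G', hi]
  have h1 : ∑ i, max (‖G i‖ ^ 2 - t) 0 = ∑ j, hG'.eigenvalues j - #s * t := by
    rw [← trace_re_eq_sum_eigenvalues, trace_frameOp_re, ← nsmul_eq_mul, ← sum_const,
      ← sum_subset (subset_univ s), ← sum_subset (subset_univ s), ← sum_sub_distrib]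
    · refine sum_congr rfl fun i hi => ?_
      have hi' : t < ‖G i‖ ^ 2 := by simpa [hs] using hi
      simp only [G', if_pos hi]
      exact max_eq_left (by linarith)
    · intro i _ hi
      simp [G', hi]
    · intro i _ hi
      have hi' : ‖G i‖ ^ 2 ≤ t := by simpa [hs] using hi
      exact max_eq_right (by linarith)
  have h2 : ∑ j, hG'.eigenvalues j - (frameOp G').rank * t
      ≤ ∑ j, max (hG'.eigenvalues j - t) 0 := by
    rw [hG'.rank_eq_card_non_zero_eigs, Fintype.card_subtype, ← nsmul_eq_mul, ← sum_const,
      ← sum_filter_add_sum_filter_not univ (fun j => hG'.eigenvalues j ≠ 0) hG'.eigenvalues,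
      ← sum_filter_add_sum_filter_not univ (fun j => hG'.eigenvalues j ≠ 0)
        fun j => max (hG'.eigenvalues j - t) 0]
    have e1 : ∑ j with ¬ hG'.eigenvalues j ≠ 0, hG'.eigenvalues j = 0 :=
      sum_eq_zero fun j hj => not_not.1 (mem_filter.1 hj).2
    have e2 : 0 ≤ ∑ j with ¬ hG'.eigenvalues j ≠ 0, max (hG'.eigenvalues j - t) 0 :=
      sum_nonneg fun j _ => le_max_right _ _
    have e3 : ∑ j with hG'.eigenvalues j ≠ 0, (hG'.eigenvalues j - t)
        ≤ ∑ j with hG'.eigenvalues j ≠ 0, max (hG'.eigenvalues j - t) 0 :=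
      sum_le_sum fun j _ => le_max_left _ _
    rw [sum_sub_distrib] at e3
    linarith
  have h3 : ∑ j, max (hG'.eigenvalues j - t) 0
      ≤ ∑ j, max ((frameOp_isHermitian G).eigenvalues j - t) 0 := by
    rw [← sum_down (fun s => max (s - t) 0) hG'.eigenvalues,
      ← sum_down (fun s => max (s - t) 0) (frameOp_isHermitian G).eigenvalues]
    refine sum_le_sum fun j _ => max_le_max_right _ (sub_le_sub_right ?_ t)
    refine down_eigenvalues_mono hG' (frameOp_isHermitian G) (fun x => ?_) j
    rw [quad_frameOp, quad_frameOp]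
    refine sum_le_sum fun i _ => ?_
    by_cases hi : i ∈ s
    · simp [G', hi]
    · simpa [G', hi] using Complex.normSq_nonneg _
  have h4 : ((frameOp G').rank : ℝ) * t ≤ #s * t :=
    mul_le_mul_of_nonneg_right (by exact_mod_cast hrank) ht
  linarith

theorem eigUp_mem_Gam {a : Fin k → ℝ} (G : Fin k → EuclideanSpace ℂ (Fin d))
    (hG : ∀ i, ‖G i‖ ^ 2 = a i) : eigUp G ∈ Gam d a := by
  refine ⟨eigUp_nonneg G, monotone_up _, majorizedSame_of_sum_posPart_le (fun l => ?_) ?_⟩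
  · set t := down (pad (max k d) (eigUp G)) l
    have ht : 0 ≤ t := down_nonneg (pad_nonneg (eigUp_nonneg G)) l
    -- As t ≥ 0, padding zeros contribute nothing to the positive parts.
    have h0 : max (0 - t) 0 = 0 := max_eq_right (by linarith)
    rw [sum_pad_of_eq_zero (g := fun s => max (s - t) 0) (le_max_left k d) h0,
      sum_pad_of_eq_zero (g := fun s => max (s - t) 0) (le_max_right k d) h0, eigUp,
      sum_up fun s => max (s - t) 0]
    simp only [← hG]
    exact sum_posPart_norm_sq_le G ht
  · have e1 := sum_pad_of_eq_zero (g := id) (le_max_left k d) rfl a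
    have e2 := sum_pad_of_eq_zero (g := id) (le_max_right k d) rfl (eigUp G)
    have e3 := sum_up id (frameOp_isHermitian G).eigenvalues
    simp only [id] at e1 e2 e3
    rw [e1, e2, eigUp, e3, ← trace_re_eq_sum_eigenvalues, trace_frameOp_re]
    exact sum_congr rfl fun i _ => (hG i).symm

end Frames

/-! ### Schur–Horn for frames by plane rotations -/

section Rotation

theorem vecMulVec_rotate (u v : Fin d → ℂ) (θ : ℝ) :
    vecMulVec ((Real.cos θ : ℂ) • u + (Real.sin θ : ℂ) • v)
        (star ((Real.cos θ : ℂ) • u + (Real.sin θ : ℂ) • v))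
      + vecMulVec (-(Real.sin θ : ℂ) • u + (Real.cos θ : ℂ) • v)
        (star (-(Real.sin θ : ℂ) • u + (Real.cos θ : ℂ) • v))
      = vecMulVec u (star u) + vecMulVec v (star v) := by
  have h : (Real.cos θ : ℂ) ^ 2 + (Real.sin θ : ℂ) ^ 2 = 1 := by
    exact_mod_cast Real.cos_sq_add_sin_sq θ
  ext i j
  simp only [Matrix.add_apply, vecMulVec_apply, Pi.add_apply, Pi.smul_apply, Pi.star_apply,
    star_add, star_smul, smul_eq_mul, RCLike.star_def, map_neg, Complex.conj_ofReal]
  linear_combination (u i * (starRingEnd ℂ) (u j) + v i * (starRingEnd ℂ) (v j)) * h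

/-- The vectors of squared norms of frames with a given frame operator are closed under
`T`-transforms. -/
theorem exists_frameOp_eq_transfer {m : ℕ} (F : Fin m → EuclideanSpace ℂ (Fin d)) {i j : Fin m}
    (hij : i ≠ j) {δ : ℝ} (h0 : 0 ≤ δ) (h1 : δ ≤ ‖F i‖ ^ 2 - ‖F j‖ ^ 2) :
    ∃ F' : Fin m → EuclideanSpace ℂ (Fin d), frameOp F' = frameOp F ∧
      ∀ l, ‖F' l‖ ^ 2 = ((fun l => ‖F l‖ ^ 2) - Pi.single i δ + Pi.single j δ : Fin m → ℝ) l := by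
  let u : ℝ → EuclideanSpace ℂ (Fin d) := fun θ =>
    (Real.cos θ : ℂ) • F i + (Real.sin θ : ℂ) • F j
  let v : ℝ → EuclideanSpace ℂ (Fin d) := fun θ =>
    -(Real.sin θ : ℂ) • F i + (Real.cos θ : ℂ) • F j
  have hcont : ContinuousOn (fun θ => ‖u θ‖ ^ 2) (Set.Icc 0 (Real.pi / 2)) := by
    apply Continuous.continuousOn
    simp only [u]
    fun_prop
  -- Rotation from 0 to π/2 carries the squared norm from that of `F i` to that of `F j`, so an
  -- intermediate angle gives the required value; trace invariance then fixes the other norm.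
  have hmem : ‖F i‖ ^ 2 - δ ∈ Set.Icc (‖u (Real.pi / 2)‖ ^ 2) (‖u 0‖ ^ 2) := by
    simp only [u, Real.cos_zero, Real.sin_zero, Real.cos_pi_div_two, Real.sin_pi_div_two]
    simp only [Complex.ofReal_one, Complex.ofReal_zero, one_smul, zero_smul, add_zero, zero_add]
    constructor <;> linarith
  obtain ⟨θ, -, hθ⟩ := intermediate_value_Icc' (by positivity) hcont hmem
  have hrot : vecMulVec (u θ).ofLp (star (u θ).ofLp) + vecMulVec (v θ).ofLp (star (v θ).ofLp)
      = vecMulVec (F i).ofLp (star (F i).ofLp) + vecMulVec (F j).ofLp (star (F j).ofLp) :=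
    vecMulVec_rotate (F i).ofLp (F j).ofLp θ
  have hv : ‖v θ‖ ^ 2 = ‖F j‖ ^ 2 + δ := by
    have h2 := congrArg (fun A => (trace A).re) hrot
    simp only [trace_add, Complex.add_re, trace_vecMulVec_star_re] at h2
    simp only at hθ
    linarith
  refine ⟨Function.update (Function.update F i (u θ)) j (v θ), ?_, fun l => ?_⟩
  · have hsplit : ∀ H : Fin m → EuclideanSpace ℂ (Fin d), frameOp H
        = vecMulVec (H i).ofLp (star (H i).ofLp) + vecMulVec (H j).ofLp (star (H j).ofLp)
          + ∑ l ∈ (univ.erase i).erase j, vecMulVec (H l).ofLp (star (H l).ofLp) := fun H => by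
      rw [frameOp, ← add_sum_erase _ _ (mem_univ i),
        ← add_sum_erase (univ.erase i) _ (mem_erase.2 ⟨hij.symm, mem_univ j⟩), add_assoc]
    rw [hsplit, hsplit F]
    congr 1
    · simpa [hij, hij.symm] using hrot
    · refine sum_congr rfl fun l hl => ?_
      simp only [mem_erase, mem_univ, and_true] at hl
      simp [hl.1, hl.2]
  · rcases eq_or_ne l j with rfl | hj
    · simpa [hij.symm] using hv
    rcases eq_or_ne l i with rfl | hi
    · simpa [hij] using hθ
    · simp [hi, hj]

/-- The Schur–Horn theorem for frames: every frame operator compatible with the prescribed norms is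
attained. -/
theorem exists_frameOp_eq_conjDiag {k : ℕ} {a : Fin k → ℝ} {μ : Fin d → ℝ}
    (hμ : μ ∈ Gam d a) (U : Matrix (Fin d) (Fin d) ℂ) (hU : U * star U = 1) :
    ∃ G : Fin k → EuclideanSpace ℂ (Fin d), frameOp G = conjDiag U μ ∧ ∀ i, ‖G i‖ ^ 2 = a i := by
  have hind : ∃ H : Fin (max k d) → EuclideanSpace ℂ (Fin d),
      frameOp H = conjDiag U μ ∧ ∀ i, ‖H i‖ ^ 2 = pad (max k d) a i := by
    refine hμ.2.2.induction (P := fun z => ∃ H : Fin (max k d) → EuclideanSpace ℂ (Fin d),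
      frameOp H = conjDiag U μ ∧ ∀ i, ‖H i‖ ^ 2 = z i) ?_ ?_ ?_
    · rintro z σ ⟨H, h1, h2⟩
      refine ⟨H ∘ σ, ?_, fun i => h2 _⟩
      rw [← h1]
      exact Equiv.sum_comp σ fun i => vecMulVec (H i).ofLp (star (H i).ofLp)
    · rintro z i j δ hij h0 h1 ⟨H, h2, h3⟩
      rw [← h3, ← h3] at h1
      obtain ⟨H', h4, h5⟩ := exists_frameOp_eq_transfer H hij h0 h1
      refine ⟨H', h4.trans h2, fun l => ?_⟩
      rw [h5, show (fun l => ‖H l‖ ^ 2) = z from funext h3]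
    · have hd : d ≤ max k d := le_max_right k d
      generalize max k d = N at hd
      obtain ⟨r, rfl⟩ := Nat.exists_eq_add_of_le hd
      -- The induction starts from scaled orthonormal eigenvectors padded with zeros, whose squared
      -- norms are `μ` padded.
      refine ⟨Fin.append (fun i => WithLp.toLp 2 ((Real.sqrt (μ i) : ℂ) • fun l => U l i))
        (fun _ => 0), ?_, fun i => ?_⟩
      · rw [frameOp, Fin.sum_univ_add]
        ext p q
        simp only [Fin.append_left, Fin.append_right, conjDiag]
        rw [mul_apply]
        simp only [Matrix.add_apply, Matrix.sum_apply, vecMulVec_apply, mul_diagonal, star_apply]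
        simp only [Pi.smul_apply, Pi.star_apply, smul_eq_mul, star_mul', RCLike.star_def,
          Complex.conj_ofReal]
        simp only [WithLp.ofLp_zero, Pi.zero_apply, zero_mul, sum_const_zero, add_zero]
        refine sum_congr rfl fun i _ => ?_
        have h : (Real.sqrt (μ i) : ℂ) * Real.sqrt (μ i) = μ i := by
          exact_mod_cast Real.mul_self_sqrt (hμ.1 i)
        linear_combination (U p i * (starRingEnd ℂ) (U q i)) * h
      · induction i using Fin.addCases with
        | left i =>
          have hcol : ∑ l, ‖U l i‖ ^ 2 = 1 := by
            have h := congrArg (fun A : Matrix (Fin d) (Fin d) ℂ => A i i) (mul_eq_one_comm.1 hU)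
            rw [mul_apply, one_apply_eq] at h
            have h2 := congrArg Complex.re h
            rw [Complex.re_sum] at h2
            rw [← Complex.one_re, ← h2]
            refine sum_congr rfl fun l _ => ?_
            rw [← Complex.normSq_eq_norm_sq, Complex.normSq_apply]
            simp
          rw [Fin.append_left, EuclideanSpace.norm_sq_eq]
          simp only [Pi.smul_apply, smul_eq_mul, norm_mul, mul_pow, ← mul_sum, hcol]
          simp [pad, Real.sq_sqrt (hμ.1 i)]
        | right i => simp [pad]
  obtain ⟨H, hH, hHn⟩ := hind
  have hk : k ≤ max k d := le_max_left k d
  generalize max k d = N at H hH hHn hk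
  obtain ⟨r, rfl⟩ := Nat.exists_eq_add_of_le hk
  refine ⟨fun i => H (Fin.castAdd r i), ?_, fun i => ?_⟩
  -- Vectors beyond the first `k` have norm zero, so dropping them leaves the operator unchanged.
  · rw [← hH, frameOp, frameOp, Fin.sum_univ_add, left_eq_add]
    refine sum_eq_zero fun i _ => ?_
    have h := hHn (Fin.natAdd k i)
    have h' : H (Fin.natAdd k i) = 0 := by simpa [pad] using h
    rw [h']
    simp
  · rw [hHn]
    simp [pad]

end Rotation

end FrameCompletion

end

/-! ### Geometry of Γ_d(a) and minimization over it -/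

noncomputable section

namespace FrameCompletion

open Finset Filter Topology

variable {d k : ℕ}

/-- For increasing `μ` the largest entries sit at the end, so sorting disappears and every condition
becomes affine in `μ`. Convexity and closedness follow. -/
theorem mem_Gam_iff {a : Fin k → ℝ} {μ : Fin d → ℝ} :
    μ ∈ Gam d a ↔ (∀ i, 0 ≤ μ i) ∧ Monotone μ ∧
      (∀ l : Fin (max k d), ∑ i ∈ Iic l, down (pad (max k d) a) i
        ≤ ∑ i with ((Fin.rev i : Fin d) : ℕ) ≤ (l : ℕ), μ i) ∧ ∑ i, a i = ∑ i, μ i := by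
  refine and_congr_right fun h0 => and_congr_right fun hm => ?_
  have e1 := sum_pad_of_eq_zero (g := id) (le_max_left k d) rfl a
  have e2 := sum_pad_of_eq_zero (g := id) (le_max_right k d) rfl μ
  simp only [id] at e1 e2
  rw [Majorized, MajorizedSame, e1, e2, down_pad (le_max_right k d) h0, down_of_monotone hm]
  refine and_congr_left fun _ => forall_congr' fun l => ?_
  rw [sum_Iic_pad (le_max_right k d), sum_filter, sum_filter,
    ← sum_comp_rev fun i : Fin d => if ((Fin.rev i : Fin d) : ℕ) ≤ (l : ℕ) then μ i else 0]
  simp only [Fin.rev_rev]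

theorem convex_Gam (a : Fin k → ℝ) : Convex ℝ (Gam d a) := by
  intro μ hμ ν hν s t hs ht hst
  rw [mem_Gam_iff] at hμ hν ⊢
  obtain ⟨h1, h2, h3, h4⟩ := hμ
  obtain ⟨g1, g2, g3, g4⟩ := hν
  simp only [Pi.add_apply, Pi.smul_apply, smul_eq_mul, sum_add_distrib, ← mul_sum]
  refine ⟨fun i => add_nonneg (mul_nonneg hs (h1 i)) (mul_nonneg ht (g1 i)), fun i j hij =>
    add_le_add (mul_le_mul_of_nonneg_left (h2 hij) hs) (mul_le_mul_of_nonneg_left (g2 hij) ht),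
    fun l => ?_, ?_⟩
  · have e1 := mul_le_mul_of_nonneg_left (h3 l) hs
    have e2 := mul_le_mul_of_nonneg_left (g3 l) ht
    have e3 : ∀ A : ℝ, A = s * A + t * A := fun A => by rw [← add_mul, hst, one_mul]
    rw [e3 (∑ i ∈ Iic l, down (pad (max k d) a) i)]
    exact add_le_add e1 e2
  · rw [← h4, ← g4, ← add_mul, hst, one_mul]

theorem convex_LamOp (a : Fin k → ℝ) (lam : Fin d → ℝ) : Convex ℝ (LamOp a lam) := by
  have h : LamOp a lam = (fun μ => down lam + μ) '' Gam d a := by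
    ext ν
    simp only [LamOp, Set.mem_ofPred_eq, Set.mem_image, eq_comm]
  rw [h]
  exact (convex_Gam a).translate _

theorem isCompact_Gam (a : Fin k → ℝ) : IsCompact (Gam d a) := by
  have hK : IsCompact (Set.univ.pi fun _ : Fin d => Set.Icc 0 (∑ i, a i)) :=
    isCompact_univ_pi fun _ => isCompact_Icc
  refine hK.of_isClosed_subset ?_ fun μ hμ => ?_
  · have h : Gam d a = {μ | (∀ i, 0 ≤ μ i) ∧ (∀ i j, i ≤ j → μ i ≤ μ j) ∧
        (∀ l : Fin (max k d), ∑ i ∈ Iic l, down (pad (max k d) a) i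
          ≤ ∑ i with ((Fin.rev i : Fin d) : ℕ) ≤ (l : ℕ), μ i) ∧ ∑ i, a i = ∑ i, μ i} :=
      Set.ext fun μ => mem_Gam_iff
    rw [h]
    simp only [Set.ofPred_and, Set.ofPred_forall]
    refine ((isClosed_iInter fun i => isClosed_le (by fun_prop) (by fun_prop)).inter
      ((isClosed_iInter fun i => isClosed_iInter fun j => isClosed_iInter fun _ =>
        isClosed_le (by fun_prop) (by fun_prop)).inter
      ((isClosed_iInter fun l => isClosed_le (by fun_prop) (by fun_prop)).inter
        (isClosed_eq (by fun_prop) (by fun_prop)))))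
  · obtain ⟨h1, -, -, h4⟩ := mem_Gam_iff.1 hμ
    exact fun i _ => ⟨h1 i, h4 ▸ single_le_sum (fun j _ => h1 j) (mem_univ i)⟩

theorem Gam_nonempty (hd : 0 < d) {a : Fin k → ℝ} (ha : ∀ i, 0 < a i) : (Gam d a).Nonempty := by
  -- Any frame with the prescribed norms supplies an element; here all vectors lie on one axis.
  refine ⟨_, eigUp_mem_Gam (d := d)
    (fun i => EuclideanSpace.single ⟨0, hd⟩ (Real.sqrt (a i) : ℂ)) fun i => ?_⟩
  simp [Real.sq_sqrt (ha i).le]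

theorem sum_transfer (μ : Fin d → ℝ) (p q : Fin d) (δ : ℝ) (s : Finset (Fin d)) :
    ∑ i ∈ s, (μ - Pi.single p δ + Pi.single q δ : Fin d → ℝ) i
      = ∑ i ∈ s, μ i - (if p ∈ s then δ else 0) + (if q ∈ s then δ else 0) := by
  simp [sum_add_distrib, sum_sub_distrib]

/-- Moving mass towards a larger entry cannot decrease any top partial sum; the gap hypotheses
preserve the order. -/
theorem transfer_mem_Gam_of_lt {a : Fin k → ℝ} {μ : Fin d → ℝ} (hμ : μ ∈ Gam d a) {p q : Fin d}
    (hpq : p < q) {δ : ℝ} (h0 : 0 ≤ δ) (hp : δ ≤ μ p) (h1 : ∀ r < p, δ ≤ μ p - μ r)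
    (h2 : ∀ r, q < r → δ ≤ μ r - μ q) : μ - Pi.single p δ + Pi.single q δ ∈ Gam d a := by
  obtain ⟨hμ0, hm, ht, hs⟩ := mem_Gam_iff.1 hμ
  set ν := μ - Pi.single p δ + Pi.single q δ with hν
  have hνp : ν p = μ p - δ := by simp [hν, hpq.ne]
  have hνq : ν q = μ q + δ := by simp [hν, hpq.ne']
  have hνr : ∀ r, r ≠ p → r ≠ q → ν r = μ r := fun r h1 h2 => by simp [hν, h1, h2]
  refine mem_Gam_iff.2 ⟨fun r => ?_, fun r s hrs => ?_, fun l => ?_, ?_⟩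
  · rcases eq_or_ne r p with rfl | hrp
    · rw [hνp]; linarith
    rcases eq_or_ne r q with rfl | hrq
    · rw [hνq]; linarith [hμ0 r]
    · rw [hνr r hrp hrq]; exact hμ0 r
  · rcases hrs.eq_or_lt with rfl | hlt
    · exact le_rfl
    have hμrs := hm hrs
    rcases eq_or_ne r q with rfl | hrq
    · rw [hνq, hνr s (hpq.trans hlt).ne' hlt.ne']
      linarith [h2 s hlt]
    have hr : ν r ≤ μ r := by
      rcases eq_or_ne r p with rfl | hrp
      · rw [hνp]; linarith
      · rw [hνr r hrp hrq]
    rcases eq_or_ne s p with rfl | hsp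
    · rw [hνp]; linarith [h1 r hlt]
    rcases eq_or_ne s q with rfl | hsq
    · rw [hνq]; linarith
    · rw [hνr s hsp hsq]; linarith
  · rw [hν, sum_transfer]
    refine (ht l).trans ?_
    simp only [mem_filter, mem_univ, true_and]
    by_cases hp' : ((Fin.rev p : Fin d) : ℕ) ≤ (l : ℕ)
    · have hq' : ((Fin.rev q : Fin d) : ℕ) ≤ (l : ℕ) :=
        le_trans (Fin.rev_le_rev.2 hpq.le : q.rev ≤ p.rev) hp'
      rw [if_pos hp', if_pos hq', sub_add_cancel]
    · rw [if_neg hp']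
      split_ifs <;> linarith
  · rw [hν, sum_transfer, hs]
    simp

theorem sum_Iic_down_pad_lt {a : Fin k → ℝ} (ha : ∀ i, 0 < a i) {m : ℕ} (hk : k ≤ m)
    {l : Fin m} (hl : (l : ℕ) + 1 < k) : ∑ i ∈ Iic l, down (pad m a) i < ∑ i, a i := by
  have h1 : ∀ i, 0 < down a i := fun i => ha _
  have h2 := sum_down id a
  simp only [id] at h2
  rw [down_pad hk fun i => (ha i).le, sum_Iic_pad hk, ← h2]
  refine sum_lt_sum_of_subset (i := ⟨l + 1, hl⟩) (subset_univ _) (mem_univ _) ?_ (h1 _)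
    fun i _ _ => (h1 i).le
  simp

/-- Moving mass down from `j` to `i` affects only the sum of the top d − j entries. That sum is all
of ∑ a, while fewer than `k` positive entries of `a` fall strictly short of it. -/
theorem transfer_pred_mem_Gam {a : Fin k → ℝ} (ha : ∀ i, 0 < a i) {μ : Fin d → ℝ}
    (hμ : μ ∈ Gam d a) {i j : Fin d} (hij : (j : ℕ) = i + 1) (hi : μ i = 0) (hj : 0 < μ j)
    (hdk : d ≤ i + k) : ∃ ε > 0, ε < μ j ∧
      ∀ δ, 0 ≤ δ → δ ≤ ε → μ - Pi.single j δ + Pi.single i δ ∈ Gam d a := by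
  obtain ⟨hμ0, hm, ht, hs⟩ := mem_Gam_iff.1 hμ
  have hlt : i < j := by rw [Fin.lt_def]; omega
  have hjd := j.isLt
  let L : Fin (max k d) := ⟨d - (j + 1), lt_max_of_lt_right (by omega)⟩
  have hL := sum_Iic_down_pad_lt ha (le_max_left k d) (l := L) (by simp only [L]; omega)
  refine ⟨min (μ j / 2) (∑ i, a i - ∑ i ∈ Iic L, down (pad (max k d) a) i),
    lt_min (by linarith) (by linarith), (min_le_left _ _).trans_lt (by linarith),
    fun δ h0 hδ => ?_⟩
  have hδ1 := hδ.trans (min_le_left _ _)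
  have hδ2 := hδ.trans (min_le_right _ _)
  have hzero : ∀ r ≤ i, μ r = 0 := fun r hr => le_antisymm (hi ▸ hm hr) (hμ0 r)
  set ν := μ - Pi.single j δ + Pi.single i δ with hν
  have hνj : ν j = μ j - δ := by simp [hν, hlt.ne']
  have hνi : ν i = δ := by simp [hν, hlt.ne, hi]
  have hνr : ∀ r, r ≠ i → r ≠ j → ν r = μ r := fun r h1 h2 => by simp [hν, h1, h2]
  have hlow : ∀ r < i, ν r = 0 := fun r hr => by
    rw [hνr r hr.ne (hr.trans hlt).ne, hzero r hr.le]
  have hhigh : ∀ r, j < r → ν r = μ r := fun r hr => hνr r (hlt.trans hr).ne' hr.ne'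
  have hcase : ∀ r, r < i ∨ r = i ∨ r = j ∨ j < r := fun r => by
    simp only [Fin.lt_def, Fin.ext_iff]; omega
  have hν0 : ∀ r, 0 ≤ ν r := fun r => by
    rcases hcase r with h | rfl | rfl | h
    · exact (hlow r h).ge
    · rw [hνi]; exact h0
    · rw [hνj]; linarith
    · rw [hhigh r h]; exact hμ0 r
  refine mem_Gam_iff.2 ⟨hν0, fun r s hrs => ?_, fun l => ?_, ?_⟩
  · rcases hrs.eq_or_lt with rfl | hrs
    · exact le_rfl
    rcases hcase r with h | rfl | rfl | h
    · rw [hlow r h]; exact hν0 s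
    · rcases hcase s with h | rfl | rfl | h
      · exact absurd h hrs.not_gt
      · exact le_rfl
      · rw [hνi, hνj]; linarith
      · rw [hνi, hhigh s h]; linarith [hm h.le]
    · rw [hνj, hhigh s hrs]; linarith [hm hrs.le]
    · rw [hhigh r h, hhigh s (h.trans hrs)]; exact hm hrs.le
  · rw [hν, sum_transfer]
    simp only [mem_filter, mem_univ, true_and, Fin.val_rev]
    rcases lt_trichotomy (l : ℕ) (d - (j + 1)) with h | h | h
    · rw [if_neg (by omega), if_neg (by omega)]
      simpa [Fin.val_rev] using ht l
    · rw [if_pos (by omega), if_neg (by omega)]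
      have hlL : l = L := Fin.ext h
      have htail : ∑ r with d - ((r : Fin d) + 1 : ℕ) ≤ (l : ℕ), μ r = ∑ r, μ r := by
        refine sum_subset (subset_univ _) fun r _ hr => hzero r ?_
        simp only [mem_filter, mem_univ, true_and, not_le] at hr
        rw [Fin.le_def]
        omega
      rw [htail, ← hs, hlL]
      linarith
    · rw [if_pos (by omega), if_pos (by omega)]
      simpa [Fin.val_rev] using ht l
  · rw [hν, sum_transfer, hs]
    simp

/-- Slopes from 1 are monotone and bounded below by the slope at 0, hence converge; the chord from 0
to 1 bounds the limit by `f 0`. -/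
theorem exists_tendsto_nhdsGT_zero {f : ℝ → ℝ} (hf : ConvexOn ℝ (Set.Ici 0) f) :
    ∃ c ≤ f 0, Tendsto f (𝓝[>] 0) (𝓝 c) := by
  have hmono : MonotoneOn (slope f 1) (Set.Ici 0 \ {1}) :=
    hf.slope_mono (by simp : (1 : ℝ) ∈ Set.Ici 0)
  have hlim : ∃ s, Tendsto (slope f 1) (𝓝[>] 0) (𝓝 s) := by
    have hm : MonotoneOn (slope f 1) (Set.Ioo 0 1) :=
      hmono.mono fun x hx => ⟨hx.1.le, hx.2.ne⟩
    have hb : BddBelow (slope f 1 '' Set.Ioo 0 1) := by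
      refine ⟨slope f 1 0, ?_⟩
      rintro _ ⟨x, hx, rfl⟩
      exact hmono (by simp) ⟨hx.1.le, hx.2.ne⟩ hx.1.le
    have h := hm.tendsto_nhdsWithin_Ioo_right (Set.nonempty_Ioo.2 zero_lt_one) hb
    exact ⟨_, h⟩
  obtain ⟨s, hs⟩ := hlim
  have hid : Tendsto (fun x : ℝ => x) (𝓝[>] 0) (𝓝 0) := tendsto_id.mono_left nhdsWithin_le_nhds
  have hf1 : Tendsto f (𝓝[>] 0) (𝓝 ((0 - 1) * s + f 1)) := by
    refine (((hid.sub_const 1).mul hs).add_const (f 1)).congr fun x => ?_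
    have := sub_smul_slope f 1 x
    simp only [smul_eq_mul, vsub_eq_sub] at this
    rw [this]
    ring
  refine ⟨_, ?_, hf1⟩
  have hf2 : Tendsto (fun x => x * f 1 + (1 - x) * f 0) (𝓝[>] 0) (𝓝 (0 * f 1 + (1 - 0) * f 0)) :=
    (hid.mul_const _).add ((hid.const_sub 1).mul_const _)
  have hle : (0 - 1) * s + f 1 ≤ 0 * f 1 + (1 - 0) * f 0 := by
    refine le_of_tendsto_of_tendsto hf1 hf2 ?_
    filter_upwards [Ioo_mem_nhdsGT (zero_lt_one' ℝ)] with x hx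
    have := hf.2 (x := 1) (y := 0) (by simp) (by simp) hx.1.le (sub_nonneg.2 hx.2.le) (by ring)
    simpa using this
  linarith

theorem continuousOn_update_zero {f : ℝ → ℝ} (hf : ConvexOn ℝ (Set.Ici 0) f) {c : ℝ}
    (hc : Tendsto f (𝓝[>] 0) (𝓝 c)) : ContinuousOn (Function.update f 0 c) (Set.Ici 0) := by
  have hcont : ContinuousOn f (Set.Ioi 0) :=
    (hf.subset Set.Ioi_subset_Ici_self (convex_Ioi 0)).continuousOn isOpen_Ioi
  intro x hx
  rcases (Set.mem_Ici.1 hx).eq_or_lt with rfl | hx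
  · rw [continuousWithinAt_update_same, Set.Ici_sdiff_left]
    exact hc
  · refine ContinuousAt.continuousWithinAt ?_
    rw [continuousAt_update_of_ne hx.ne']
    exact hcont.continuousAt (Ioi_mem_nhds hx)

/-- Splitting mass off a positive point lowers the sum of `f`, even when the value of `f` at zero
is replaced by the limit of `f` there. -/
theorem exists_add_lt_limit_add {f : ℝ → ℝ} (hf : StrictConvexOn ℝ (Set.Ici 0) f) {c : ℝ}
    (hc : Tendsto f (𝓝[>] 0) (𝓝 c)) {x ε : ℝ} (h0 : 0 < ε) (h1 : ε < x) :
    ∃ δ > 0, δ ≤ ε ∧ f δ + f (x - δ) < c + f x := by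
  set δ := min ε (x / 2) with hδ
  have hδε : δ ≤ ε := min_le_left _ _
  have hδx : δ ≤ x / 2 := min_le_right _ _
  have hδ0 : 0 < δ := lt_min h0 (by linarith)
  have hcont : ContinuousAt f x :=
    ((hf.convexOn.subset Set.Ioi_subset_Ici_self (convex_Ioi 0)).continuousOn
      isOpen_Ioi).continuousAt (Ioi_mem_nhds (h0.trans h1))
  have hlim : Tendsto (fun η => f η + f (x - η)) (𝓝[>] 0) (𝓝 (c + f (x - 0))) := by
    refine hc.add (Tendsto.comp (y := 𝓝 (x - 0)) ?_ ?_)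
    · simpa using hcont.tendsto
    · exact (tendsto_id.mono_left nhdsWithin_le_nhds).const_sub x
  have hdec : ∀ {η η' : ℝ}, 0 < η → η < η' → η' ≤ x / 2 →
      f η' + f (x - η') < f η + f (x - η) := fun {η η'} h h' h'' => by
    have := strictConvexOn_add_lt hf (p := x - η) (q := η) (δ := η' - η) h.le (by linarith)
      (by linarith)
    rw [show x - η - (η' - η) = x - η' by ring, show η + (η' - η) = η' by ring] at this
    linarith
  refine ⟨δ, hδ0, hδε, ?_⟩
  -- Passing to the limit loses strictness; stopping at δ/2 leaves a strict decrease from there to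
  -- δ.
  have hge : f (δ / 2) + f (x - δ / 2) ≤ c + f (x - 0) := by
    refine ge_of_tendsto hlim ?_
    filter_upwards [Ioo_mem_nhdsGT (half_pos hδ0)] with η hη
    exact (hdec hη.1 hη.2 (by linarith)).le
  rw [sub_zero] at hge
  exact (hdec (half_pos hδ0) (half_lt_self hδ0) hδx).trans_le hge

theorem exists_minimizer (hd : 0 < d) {f : ℝ → ℝ} (hf : StrictConvexOn ℝ (Set.Ici 0) f)
    {a : Fin k → ℝ} (ha : ∀ i, 0 < a i) {lam : Fin d → ℝ} (h0 : ∀ i, 0 ≤ lam i)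
    (hlam : Antitone lam) (hk : ∀ i, lam i = 0 → d ≤ i + k) :
    ∃ μ ∈ Gam d a, ∀ γ ∈ Gam d a, sumF f (lam + μ) ≤ sumF f (lam + γ) := by
  obtain ⟨c, hc0, hc⟩ := exists_tendsto_nhdsGT_zero hf.convexOn
  set g := Function.update f 0 c with hg
  have hgf : ∀ x, x ≠ 0 → g x = f x := fun x hx => Function.update_of_ne hx _ _
  have hgle : ∀ x, g x ≤ f x := fun x => by
    rcases eq_or_ne x 0 with rfl | hx
    · simpa [hg] using hc0
    · exact (hgf x hx).le
  have hcont : ContinuousOn (fun γ => sumF g (lam + γ)) (Gam d a) := by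
    refine continuousOn_finsetSum _ fun i _ => ?_
    refine (continuousOn_update_zero hf.convexOn hc).comp (by fun_prop) fun γ hγ => ?_
    exact add_nonneg (h0 i) (hγ.1 i)
  obtain ⟨μ, hμ, hmin⟩ := (isCompact_Gam a).exists_isMinOn (Gam_nonempty hd ha) hcont
  refine ⟨μ, hμ, fun γ hγ => ?_⟩
  -- Take the last zero of `lam + μ`. If it has a successor, splitting mass off that successor
  -- contradicts minimality for `g`; otherwise `μ` vanishes, contradicting ∑ a > 0.
  have hpos : ∀ i, lam i + μ i ≠ 0 := by
    by_contra! hne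
    obtain ⟨i, hi, himax⟩ := WellFounded.has_min (wellFounded_gt (α := Fin d))
      {i | lam i + μ i = 0} hne
    have hi' : lam i + μ i = 0 := hi
    have hli : lam i = 0 := by linarith [h0 i, hμ.1 i]
    have hμi : μ i = 0 := by linarith
    have hdk := hk i hli
    have hid := i.isLt
    by_cases hlast : (i : ℕ) + 1 < d
    · set j : Fin d := ⟨i + 1, hlast⟩ with hj
      have hij : i < j := Fin.lt_def.2 (Nat.lt_succ_self _)
      have hlj : lam j = 0 := le_antisymm (hli ▸ hlam hij.le) (h0 j)
      have hμj : 0 < μ j := (hμ.1 j).lt_of_ne fun h => himax j (by simp [hlj, ← h]) hij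
      obtain ⟨ε, hε0, hεj, hε⟩ := transfer_pred_mem_Gam ha hμ rfl hμi hμj hdk
      obtain ⟨δ, hδ0, hδε, hδ⟩ := exists_add_lt_limit_add hf hc hε0 hεj
      have h1 : sumF g (lam + μ) ≤ sumF g (lam + (μ - Pi.single j δ + Pi.single i δ)) :=
        hmin (hε δ hδ0.le hδε)
      have h2 := sumF_transfer g (lam + μ) hij.ne' δ
      rw [← add_assoc, add_sub_assoc'] at h1
      simp only [Pi.add_apply, hlj, hli, hμi, zero_add] at h2
      rw [hgf _ hμj.ne', hgf _ hδ0.ne', hgf (μ j - δ) (by linarith : 0 < μ j - δ).ne',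
        show g 0 = c by simp [hg]] at h2
      linarith
    · have hall : ∑ r, μ r = 0 := sum_eq_zero fun r _ =>
        le_antisymm (hμi ▸ hμ.2.1 (by rw [Fin.le_def]; omega)) (hμ.1 r)
      have hs := (mem_Gam_iff.1 hμ).2.2.2
      have hapos : 0 < ∑ i, a i :=
        sum_pos (fun i _ => ha i) ⟨⟨0, by omega⟩, mem_univ _⟩
      linarith
  calc sumF f (lam + μ) = sumF g (lam + μ) := sum_congr rfl fun i _ => (hgf _ (hpos i)).symm
    _ ≤ sumF g (lam + γ) := hmin hγ
    _ ≤ sumF f (lam + γ) := sum_le_sum fun i _ => hgle _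

theorem minimizer_unique {f : ℝ → ℝ} (hf : StrictConvexOn ℝ (Set.Ici 0) f) {a : Fin k → ℝ}
    {lam : Fin d → ℝ} (h0 : ∀ i, 0 ≤ lam i) {μ ν : Fin d → ℝ} (hμ : μ ∈ Gam d a)
    (hν : ν ∈ Gam d a) (hmin : ∀ γ ∈ Gam d a, sumF f (lam + μ) ≤ sumF f (lam + γ))
    (hle : sumF f (lam + ν) ≤ sumF f (lam + μ)) : ν = μ := by
  by_contra hne
  have h1 := sumF_midpoint_lt hf (x := lam + ν) (y := lam + μ)
    (fun i => add_nonneg (h0 i) (hν.1 i)) (fun i => add_nonneg (h0 i) (hμ.1 i))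
    fun h => hne (add_left_cancel h)
  have h2 := hmin _ (convex_Gam a hν hμ
    (by norm_num : (0 : ℝ) ≤ 1 / 2) (by norm_num : (0 : ℝ) ≤ 1 / 2) (by norm_num))
  have h3 : lam + ((1 / 2 : ℝ) • ν + (1 / 2 : ℝ) • μ)
      = fun i => (1 / 2) * (lam + ν) i + (1 / 2) * (lam + μ) i := by
    ext i
    simp only [Pi.add_apply, Pi.smul_apply, smul_eq_mul]
    ring
  rw [h3] at h2
  linarith

theorem minimizer_eq_imp {f : ℝ → ℝ} (hf : StrictConvexOn ℝ (Set.Ici 0) f) {a : Fin k → ℝ}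
    {lam : Fin d → ℝ} (h0 : ∀ i, 0 ≤ lam i) (hlam : Antitone lam) {μ : Fin d → ℝ}
    (hμ : μ ∈ Gam d a) (hmin : ∀ γ ∈ Gam d a, sumF f (lam + μ) ≤ sumF f (lam + γ))
    {i j : Fin d} (hij : i < j) (hpos : 0 < μ i) (heq : μ i = μ j) : lam i = lam j := by
  by_contra hne
  have hlt : lam j < lam i := (hlam hij.le).lt_of_ne (Ne.symm hne)
  have hm := hμ.2.1
  -- Transferring between the two ends `p`, `q` of the plateau, rather than between `i` and `j`,
  -- keeps `μ` increasing. Since λ_p > λ_q, a small transfer brings the entries of λ+μ closer.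
  obtain ⟨p, hp, hpmin⟩ := WellFounded.has_min (wellFounded_lt (α := Fin d))
    {r | μ r = μ i} ⟨i, rfl⟩
  obtain ⟨q, hq, hqmax⟩ := WellFounded.has_min (wellFounded_gt (α := Fin d))
    {r | μ r = μ i} ⟨i, rfl⟩
  have hp' : μ p = μ i := hp
  have hq' : μ q = μ i := hq
  have hpi : p ≤ i := not_lt.1 (hpmin i rfl)
  have hjq : j ≤ q := not_lt.1 (hqmax j heq.symm)
  have hpq : p < q := hpi.trans_lt (hij.trans_le hjq)
  have hlpq : lam q < lam p := ((hlam hjq).trans_lt hlt).trans_le (hlam hpi)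
  have ev : ∀ x : ℝ, 0 < x → ∀ᶠ δ in 𝓝[>] (0 : ℝ), δ < x := fun x hx =>
    (eventually_lt_nhds hx).filter_mono nhdsWithin_le_nhds
  have h1 : ∀ᶠ δ in 𝓝[>] (0 : ℝ), ∀ r < p, δ < μ p - μ r := by
    refine eventually_all.2 fun r => ?_
    by_cases hr : r < p
    · have : μ r < μ p := (hm hr.le).lt_of_ne fun h => hpmin r (h.trans hp') hr
      filter_upwards [ev (μ p - μ r) (by linarith)] with δ hδ _ using hδ
    · simp [hr]
  have h2 : ∀ᶠ δ in 𝓝[>] (0 : ℝ), ∀ r, q < r → δ < μ r - μ q := by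
    refine eventually_all.2 fun r => ?_
    by_cases hr : q < r
    · have : μ q < μ r := (hm hr.le).lt_of_ne fun h => hqmax r (h.symm.trans hq') hr
      filter_upwards [ev (μ r - μ q) (by linarith)] with δ hδ _ using hδ
    · simp [hr]
  obtain ⟨δ, hδ0, hδ1, hδ2, hδ3, hδ4⟩ := (eventually_mem_nhdsWithin.and
    (h1.and (h2.and ((ev (μ p) (hp' ▸ hpos)).and (ev (lam p - lam q) (by linarith)))))).exists
  rw [Set.mem_Ioi] at hδ0
  have h3 := hmin _ (transfer_mem_Gam_of_lt hμ hpq hδ0.le hδ3.le (fun r hr => (hδ1 r hr).le)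
    fun r hr => (hδ2 r hr).le)
  have h4 := sumF_transfer f (lam + μ) hpq.ne δ
  have h5 := strictConvexOn_add_lt hf (p := (lam + μ) p) (q := (lam + μ) q) (δ := δ)
    (add_nonneg (h0 q) (hμ.1 q)) hδ0 (by simp only [Pi.add_apply]; linarith)
  rw [← add_assoc, add_sub_assoc'] at h3
  linarith

/-- Nonzero eigenvalues precede a zero one, so the zero-based index `i` bounds the rank. -/
theorem le_add_of_eigDown_eq_zero {n₀ : ℕ} {F₀ : Fin n₀ → EuclideanSpace ℂ (Fin d)}
    (hrank : d ≤ (frameOp F₀).rank + k) {i : Fin d} (hi : eigDown F₀ i = 0) : d ≤ i + k := by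
  have h1 : (frameOp F₀).rank ≤ i := by
    have h2 := sum_down (fun s => if s ≠ 0 then 1 else 0) (frameOp_isHermitian F₀).eigenvalues
    rw [← sum_filter, ← sum_filter] at h2
    simp only [sum_const, nsmul_eq_mul, mul_one, Nat.cast_inj] at h2
    rw [(frameOp_isHermitian F₀).rank_eq_card_non_zero_eigs, Fintype.card_subtype, ← h2,
      ← Fin.card_Iio i]
    refine card_le_card fun j hj => ?_
    rw [mem_Iio]
    by_contra hle
    exact (mem_filter.1 hj).2 (le_antisymm
      (hi ▸ antitone_down (frameOp_isHermitian F₀).eigenvalues (not_lt.1 hle))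
      (eigDown_nonneg F₀ j))
  omega

end FrameCompletion

end

/-! ### From the vector problem back to frames -/

noncomputable section

namespace FrameCompletion

variable {d n₀ k : ℕ}

theorem sumF_add_eigUp_le_potential (f : ℝ → ℝ) (hf : ConvexOn ℝ (Set.Ici 0) f)
    {F₀ : Fin n₀ → EuclideanSpace ℂ (Fin d)} {a : Fin k → ℝ}
    {F : Fin (n₀ + k) → EuclideanSpace ℂ (Fin d)} (hF : F ∈ completions F₀ a) :
    sumF f (eigDown F₀ + eigUp (added F)) ≤ potential f F := by
  rw [potential_eq_sumF]
  exact sumF_le_of_majorizedSame hf (eigDown_nonneg F)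
    (majorizedSame_down_add_up _ _ _ (frameOp_completion hF))

theorem mem_opCompletions_of_potential_le {f : ℝ → ℝ} (hf : StrictConvexOn ℝ (Set.Ici 0) f)
    {F₀ : Fin n₀ → EuclideanSpace ℂ (Fin d)} {a : Fin k → ℝ}
    {F : Fin (n₀ + k) → EuclideanSpace ℂ (Fin d)} (hF : F ∈ completions F₀ a)
    (hle : potential f F ≤ sumF f (eigDown F₀ + eigUp (added F))) : F ∈ opCompletions F₀ a := by
  rw [potential_eq_sumF] at hle
  have h := down_eq_of_majorizedSame_of_sumF_le hf
    (fun i => add_nonneg (eigDown_nonneg F₀ i) (eigUp_nonneg (added F) i)) (eigDown_nonneg F)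
    (majorizedSame_down_add_up _ _ _ (frameOp_completion hF)) hle
  exact ⟨hF, ((down_eq_self (antitone_down _)).symm.trans h.symm)⟩

theorem exists_completion_potential_eq (f : ℝ → ℝ) (F₀ : Fin n₀ → EuclideanSpace ℂ (Fin d))
    {a : Fin k → ℝ} {μ : Fin d → ℝ} (hμ : μ ∈ Gam d a) :
    ∃ F ∈ completions F₀ a, potential f F = sumF f (eigDown F₀ + μ) := by
  obtain ⟨U, hU, h₀⟩ := exists_conjDiag_down (frameOp_isHermitian F₀)
  -- Using the eigenbasis of S_{F₀} for S_G makes the eigenvalues add entrywise.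
  obtain ⟨G, hG, hn⟩ := exists_frameOp_eq_conjDiag hμ U hU
  have hadded : added (Fin.append F₀ G) = G := funext fun i => Fin.append_right F₀ G i
  have hF : Fin.append F₀ G ∈ completions F₀ a :=
    ⟨fun i => Fin.append_left F₀ G i, by rwa [hadded]⟩
  refine ⟨_, hF, ?_⟩
  have hS : frameOp (Fin.append F₀ G) = conjDiag U (eigDown F₀ + μ) := by
    rw [frameOp_completion hF, hadded, hG, ← conjDiag_add]
    exact congrArg (· + conjDiag U μ) h₀
  have h : ∀ (A : Matrix (Fin d) (Fin d) ℂ) (hA : A.IsHermitian),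
      A = conjDiag U (eigDown F₀ + μ) → sumF f hA.eigenvalues = sumF f (eigDown F₀ + μ) := by
    rintro A hA rfl
    exact sum_eigenvalues_conjDiag hU _ hA f
  rw [potential_eq_sumF, eigDown, sumF_down]
  exact h _ _ hS

theorem describesMinimizers_of_minimizer {f : ℝ → ℝ} (hf : StrictConvexOn ℝ (Set.Ici 0) f)
    (F₀ : Fin n₀ → EuclideanSpace ℂ (Fin d)) {a : Fin k → ℝ} {μ : Fin d → ℝ} (hμ : μ ∈ Gam d a)
    (hmin : ∀ γ ∈ Gam d a, sumF f (eigDown F₀ + μ) ≤ sumF f (eigDown F₀ + γ)) :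
    DescribesMinimizers f F₀ a μ := by
  refine fun F => ⟨fun hF => ?_, fun hF => ⟨hF.1.1, fun F' hF' => ?_⟩⟩
  · obtain ⟨E, hE, hEμ⟩ := exists_completion_potential_eq f F₀ hμ
    have h1 := hF.2 E hE
    have h2 := sumF_add_eigUp_le_potential f hf.convexOn hF.1
    have hG : eigUp (added F) ∈ Gam d a := eigUp_mem_Gam _ hF.1.2
    have h3 := hmin _ hG
    exact ⟨mem_opCompletions_of_potential_le hf hF.1 (by linarith),
      minimizer_unique hf (eigDown_nonneg F₀) hμ hG hmin (by linarith)⟩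
  · rw [potential_eq_sumF, hF.1.2, hF.2, sumF_down]
    exact (hmin _ (eigUp_mem_Gam _ hF'.2)).trans (sumF_add_eigUp_le_potential f hf.convexOn hF')

/-- Without an actual minimizer, the description by `μ` could be vacuous and would not determine
`μ`. -/
theorem exists_isGlobalMinimizer {f : ℝ → ℝ} (hf : ConvexOn ℝ (Set.Ici 0) f)
    (F₀ : Fin n₀ → EuclideanSpace ℂ (Fin d)) {a : Fin k → ℝ} {μ : Fin d → ℝ} (hμ : μ ∈ Gam d a)
    (hmin : ∀ γ ∈ Gam d a, sumF f (eigDown F₀ + μ) ≤ sumF f (eigDown F₀ + γ)) :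
    ∃ F, IsGlobalMinimizer f F₀ a F := by
  obtain ⟨E, hE, hEμ⟩ := exists_completion_potential_eq f F₀ hμ
  refine ⟨E, hE, fun F' hF' => ?_⟩
  rw [hEμ]
  exact (hmin _ (eigUp_mem_Gam _ hF'.2)).trans (sumF_add_eigUp_le_potential f hf hF')

end FrameCompletion

end

theorem mainTheorem3 {d n₀ k : ℕ} (hd : 0 < d)
    (F₀ : Fin n₀ → EuclideanSpace ℂ (Fin d)) (a : Fin k → ℝ) (ha : ∀ i, 0 < a i)
    (hrank : d ≤ (FrameCompletion.frameOp F₀).rank + k)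
    (f : ℝ → ℝ) (hf : StrictConvexOn ℝ (Set.Ici 0) f) :
    Convex ℝ (FrameCompletion.LamOp a (FrameCompletion.eigDown F₀)) ∧
    ∃ μ ∈ FrameCompletion.Gam d a,
      -- the global minimizers, and uniqueness of the vector describing them
      FrameCompletion.DescribesMinimizers f F₀ a μ ∧
      (∀ μ' ∈ FrameCompletion.Gam d a,
        FrameCompletion.DescribesMinimizers f F₀ a μ' → μ' = μ) ∧
      -- the variational characterization
      IsLeast ((fun γ => FrameCompletion.sumF f (FrameCompletion.eigDown F₀ + γ)) ''
          FrameCompletion.Gam d a)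
        (FrameCompletion.sumF f (FrameCompletion.eigDown F₀ + μ)) ∧
      IsLeast (FrameCompletion.sumF f ''
          FrameCompletion.LamOp a (FrameCompletion.eigDown F₀))
        (FrameCompletion.sumF f (FrameCompletion.eigDown F₀ + μ)) ∧
      (∀ μ' ∈ FrameCompletion.Gam d a,
        (∀ γ ∈ FrameCompletion.Gam d a,
          FrameCompletion.sumF f (FrameCompletion.eigDown F₀ + μ') ≤
            FrameCompletion.sumF f (FrameCompletion.eigDown F₀ + γ)) → μ' = μ) ∧
      -- equal consecutive positive entries
      (∀ i j : Fin d, (j : ℕ) = (i : ℕ) + 1 → 0 < μ i → μ i = μ j →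
        FrameCompletion.eigDown F₀ i = FrameCompletion.eigDown F₀ j) := by
  have h0 := FrameCompletion.eigDown_nonneg F₀
  have hlam : Antitone (FrameCompletion.eigDown F₀) := FrameCompletion.antitone_down _
  obtain ⟨μ, hμ, hmin⟩ := FrameCompletion.exists_minimizer hd hf ha h0 hlam
    fun i hi => FrameCompletion.le_add_of_eigDown_eq_zero hrank hi
  have hdesc := FrameCompletion.describesMinimizers_of_minimizer hf F₀ hμ hmin
  refine ⟨FrameCompletion.convex_LamOp _ _, μ, hμ, hdesc, fun μ' _ hμ' => ?_,
    ⟨⟨μ, hμ, rfl⟩, ?_⟩, ⟨⟨_, ⟨μ, hμ, ?_⟩, rfl⟩, ?_⟩, fun μ' hμ' hmin' => ?_,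
    fun i j hij hpos heq => ?_⟩
  · obtain ⟨E, hE⟩ := FrameCompletion.exists_isGlobalMinimizer hf.convexOn F₀ hμ hmin
    exact ((hμ' E).1 hE).2.symm.trans ((hdesc E).1 hE).2
  · rintro _ ⟨γ, hγ, rfl⟩
    exact hmin γ hγ
  -- `LamOp` sorts its argument, which is already decreasing here.
  · rw [FrameCompletion.down_eq_self hlam]
  · rintro _ ⟨_, ⟨γ, hγ, rfl⟩, rfl⟩
    rw [FrameCompletion.down_eq_self hlam]
    exact hmin γ hγ
  · exact FrameCompletion.minimizer_unique hf h0 hμ hμ' hmin (hmin' μ hμ)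
  · exact FrameCompletion.minimizer_eq_imp hf h0 hlam hμ hmin (Fin.lt_def.2 (by omega)) hpos heq
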